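/- **Theorem 2.1 (Floquet Formula).** Let $\mathcal G$ be a connected finite graph (self-loops and multiple edges allowed) without leaves (vertices of degree $1$; a self-loop counts twice in the degree), with vertex set $V$, $p=\#V$, and let $E$ be its set of edges, each with a chosen orientation; let $\tilde E$ be the set of all directed edges, $\check e$ the reverse of $e\in\tilde E$, and $\sigma(e),\tau(e)$ the initial and final vertices of $e$. Let $b_v\in\mathbb R$ $(v\in V)$ and $a_e=a_{\check e}>0$ $(e\in\tilde E)$. Let $\pi:\mathcal T\to\mathcal G$ be the universal cover (a tree), and let $H$ be the bounded self-adjoint operator on $\ell^2(V(\mathcal T))$ with matrix $H_{xx}=b_{\pi(x)}$, $H_{xy}=a_{\pi(xy)}$ if $(xy)$ is an edge of $\mathcal T$, and $H_{xy}=0$ otherwise. For $u\in V$ pick $\tilde u\in V(\mathcal T)$ with $\pi(\tilde u)=u$; let $d\mu_u$ be the spectral measure of $H$ at $\delta_{\tilde u}$, put $dk=\frac1p\sum_{u\in V}d\mu_u$ and $G_u(z)=\langle\delta_{\tilde u},(H-z)^{-1}\delta_{\tilde u}\rangle$. For $e\in\tilde E$ pick a directed edge $\tilde e$ of $\mathcal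 T$ with $\pi(\tilde e)=e$; let $H^+_{\tilde e}$ be the Jacobi operator with the restricted parameters on $\ell^2$ of that component of $\mathcal T$ with the edge $\tilde e$ removed which contains $\tau(\tilde e)$, and put $m_e(z)=\langle\delta_{\tau(\tilde e)},(H^+_{\tilde e}-z)^{-1}\delta_{\tau(\tilde e)}\rangle$ and $$Q_e(z)=\frac1{1-a_e^2\,m_e(z)\,m_{\check e}(z)} .$$ For $z\in\mathbb C_+=\{\operatorname{Im}z>0\}$ put $\Phi(z)=\exp\left(p\int\log(t-z)\,dk(t)\right)$, with the principal branch of $\log$ (the integrand is $dk$-integrable). Then, for every choice of the lifts: 1. For all $z\in\mathbb C_+$, $$\Phi(z)=\frac{\prod_{e\in E}Q_e(z)}{\prod_{u\in V}G_u(z)} .$$ 2. Let $\Omega$ be the union of $\mathbb C\setminus\operatorname{spec}(H)$ and the set of those eigenvalues of $H$ which are isolated points of $\operatorname{spec}(H)$. The right side of the formula in 1 is meromorphic on $\Omega$, and so is a meromorphic continuation of $\Phi$ to $\Omega$. Here every $w\in\Omega$ has a punctured neighborhood on which all the resolvents in the definitions of $G_u$ and $m_e$ exist, and all $G_u$ and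 all $1-a_e^2m_em_{\check e}$ are non-zero; the values of the right side at the remaining points are immaterial. 3. $\Phi$ is an algebraic function: there is a non-zero polynomial $P\in\mathbb C[z,w]$ with $P(z,\Phi(z))=0$ for all $z\in\mathbb C_+$. -/

import Mathlib

open scoped ENNReal Topology Polynomial

noncomputable section

/-! ### Finite graphs with self-loops and multiple edges -/

/-- A graph (self-loops and multiple edges allowed) with vertex set `V`.  `D` is the set of all
directed edges: every undirected edge gives two elements `d` and `inv d` of `D`, also when it is a
self-loop. -/
structure MGraph (V D : Type*) where
  src : D → V
  inv : D → D
  inv_inv : ∀ d, inv (inv d) = d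
  inv_ne : ∀ d, inv d ≠ d

namespace MGraph

variable {V D : Type*}

/-- The final vertex of a directed edge. -/
def tgt (G : MGraph V D) (d : D) : V := G.src (G.inv d)

/-- The graph is nonempty and any two vertices are joined by a path. -/
def Connected (G : MGraph V D) : Prop :=
  Nonempty V ∧ ∀ u v : V, Relation.ReflTransGen (fun x y => ∃ d, G.src d = x ∧ G.tgt d = y) u v

/-- The degree of a vertex; a self-loop counts twice. -/
def degree (G : MGraph V D) (v : V) : ℕ := Nat.card {d : D // G.src d = v}

/-- No vertex is a leaf. -/
def Leafless (G : MGraph V D) : Prop := ∀ v, G.degree v ≠ 1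

/-- `E` contains exactly one of the two directions of every edge, that is, `E` is the edge set of
the graph, each edge being given a chosen orientation. -/
def IsOrientation (G : MGraph V D) (E : Finset D) : Prop := ∀ d, d ∈ E ↔ G.inv d ∉ E

end MGraph

/-- Jacobi parameters of a graph: a real potential `b` on the vertices, and a positive coupling `a`
on the edges (the same for both directions of an edge). -/
structure JacobiParameters {V D : Type*} (G : MGraph V D) where
  b : V → ℝ
  a : D → ℝ
  a_pos : ∀ d, 0 < a d
  a_inv : ∀ d, a (G.inv d) = a d

/-! ### The universal cover -/

/-- A universal cover of `G`: a tree on the vertex set `X` together with a covering map onto `G`,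
i.e. a graph morphism (`proj` on vertices, `dartProj` on directed edges) which maps the directed
edges starting at `x` bijectively to those starting at `proj x`, for every vertex `x`. -/
structure UniversalCover {V D : Type*} (G : MGraph V D) (X : Type*) where
  tree : SimpleGraph X
  isTree : tree.IsTree
  proj : X → V
  dartProj : tree.Dart → D
  src_dartProj : ∀ e, G.src (dartProj e) = proj e.fst
  dartProj_symm : ∀ e, dartProj e.symm = G.inv (dartProj e)
  existsUnique_lift : ∀ (x : X) (d : D), G.src d = proj x →
    ∃! e : tree.Dart, e.fst = x ∧ dartProj e = d

/-! #### Existence: the tree of reduced paths issuing from a base vertex -/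

namespace MGraph

variable {V D : Type*} (G : MGraph V D) (v₀ : V)

/-- The final vertex of a path from `v₀`, which is written as the list of its directed edges in
reverse order. -/
def endVertex : List D → V
  | [] => v₀
  | d :: _ => G.tgt d

/-- The list, read in reverse order, is a path from `v₀` without backtracking. -/
def IsReducedPath : List D → Prop
  | [] => True
  | d :: l => G.src d = G.endVertex v₀ l ∧ (∀ d' ∈ l.head?, d ≠ G.inv d') ∧ IsReducedPath l

/-- The paths from `v₀` without backtracking. -/
def ReducedPath : Type _ := {l : List D // G.IsReducedPath v₀ l}

/-- Two reduced paths are adjacent if one of them extends the other by one edge. -/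
def pathTree : SimpleGraph (G.ReducedPath v₀) where
  Adj x y := (∃ d, y.1 = d :: x.1) ∨ ∃ d, x.1 = d :: y.1
  symm := ⟨fun _ _ h => h.symm⟩
  loopless := ⟨fun x h => by rcases h with ⟨d, h⟩ | ⟨d, h⟩ <;> simp at h⟩

theorem pathTree_isTree : (G.pathTree v₀).IsTree := by
  have hreach : ∀ (l : List D) (h : G.IsReducedPath v₀ l),
      (G.pathTree v₀).Reachable ⟨l, h⟩ ⟨[], trivial⟩ := by
    intro l
    induction l with
    | nil => intro h; exact SimpleGraph.Reachable.refl _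
    | cons d l ih =>
      intro h
      refine SimpleGraph.Reachable.trans (SimpleGraph.Adj.reachable ?_) (ih h.2.2)
      exact Or.inr ⟨d, rfl⟩
  have hbr : ∀ (x y : G.ReducedPath v₀) (d : D), y.1 = d :: x.1 →
      ¬ ((G.pathTree v₀).deleteEdges {s(x, y)}).Reachable y x := by
    rintro x y d hd ⟨w⟩
    have hS : ∀ (p q : G.ReducedPath v₀)
        (_ : ((G.pathTree v₀).deleteEdges {s(x, y)}).Walk p q), y.1 <:+ p.1 → y.1 <:+ q.1 := by
      intro p q w
      induction w with
      | nil => exact id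
      | @cons p r q hadj _ ih =>
        intro hp
        refine ih ?_
        rw [SimpleGraph.deleteEdges_adj] at hadj
        obtain ⟨h | h, hne⟩ := hadj
        · obtain ⟨e, h⟩ := h
          rw [h]
          exact hp.trans (List.suffix_cons e p.1)
        · obtain ⟨e, h⟩ := h
          rw [h, List.suffix_cons_iff] at hp
          rcases hp with hp | hp
          · exfalso
            apply hne
            have e1 : y = p := Subtype.ext (hp.trans h.symm)
            have e2 : x = r := by
              rw [hd] at hp
              exact Subtype.ext (List.cons.inj hp).2
            rw [e1, e2]
            simp [Sym2.eq_swap]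
          · exact hp
    have := (hS y x w List.suffix_rfl).length_le
    rw [hd] at this
    simp at this
  rw [SimpleGraph.isTree_iff, SimpleGraph.isAcyclic_iff_forall_adj_isBridge]
  refine ⟨{ preconnected := fun x y => (hreach x.1 x.2).trans (hreach y.1 y.2).symm
            nonempty := ⟨⟨[], trivial⟩⟩ }, ?_⟩
  intro x y h
  rw [SimpleGraph.isBridge_iff]
  rcases h with ⟨d, h⟩ | ⟨d, h⟩
  · exact fun hr => hbr x y d h hr.symm
  · rw [Sym2.eq_swap]
    exact hbr y x d h

open Classical in
/-- The projection of a directed edge of the tree of reduced paths. -/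
def pathDart (e : (G.pathTree v₀).Dart) : D :=
  if h : ∃ d, e.snd.1 = d :: e.fst.1 then h.choose
  else G.inv (e.adj.resolve_left h).choose

theorem pathDart_out (e : (G.pathTree v₀).Dart) {d : D} (h : e.snd.1 = d :: e.fst.1) :
    G.pathDart v₀ e = d := by
  have h' : ∃ d, e.snd.1 = d :: e.fst.1 := ⟨d, h⟩
  rw [pathDart, dif_pos h']
  exact (List.cons.inj (h'.choose_spec.symm.trans h)).1

theorem pathDart_in (e : (G.pathTree v₀).Dart) {d : D} (h : e.fst.1 = d :: e.snd.1) :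
    G.pathDart v₀ e = G.inv d := by
  have h' : ¬ ∃ d, e.snd.1 = d :: e.fst.1 := by
    rintro ⟨d', h2⟩
    rw [h2] at h
    have h3 := congrArg List.length h
    simp only [List.length_cons] at h3
    omega
  rw [pathDart, dif_neg h']
  congr 1
  exact (List.cons.inj ((e.adj.resolve_left h').choose_spec.symm.trans h)).1

/-- The tree of reduced paths is a universal cover. -/
def pathCover : UniversalCover G (G.ReducedPath v₀) where
  tree := G.pathTree v₀
  isTree := G.pathTree_isTree v₀
  proj x := G.endVertex v₀ x.1
  dartProj := G.pathDart v₀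
  src_dartProj e := by
    rcases e.adj with ⟨d, h⟩ | ⟨d, h⟩
    · have h2 := e.snd.2
      rw [h] at h2
      rw [G.pathDart_out v₀ e h, h2.1]
    · rw [G.pathDart_in v₀ e h, h]
      rfl
  dartProj_symm e := by
    rcases e.adj with ⟨d, h⟩ | ⟨d, h⟩
    · rw [G.pathDart_out v₀ e h, G.pathDart_in v₀ e.symm h]
    · rw [G.pathDart_in v₀ e h, G.pathDart_out v₀ e.symm h, G.inv_inv]
  existsUnique_lift := by
    rintro ⟨x, hx⟩ d hd
    change G.src d = G.endVertex v₀ x at hd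
    by_cases hb : ∀ d' ∈ x.head?, d ≠ G.inv d'
    · refine ⟨⟨(⟨x, hx⟩, ⟨d :: x, hd, hb, hx⟩), Or.inl ⟨d, rfl⟩⟩, ⟨rfl, ?_⟩, ?_⟩
      · exact G.pathDart_out v₀ _ rfl
      · rintro ⟨⟨x', y⟩, hadj⟩ ⟨h1, h2⟩
        change x' = _ at h1
        subst h1
        rcases id hadj with ⟨d', h⟩ | ⟨d', h⟩
        · rw [G.pathDart_out v₀ _ h] at h2
          subst h2
          have : y = ⟨d' :: x, hd, hb, hx⟩ := Subtype.ext h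
          subst this
          rfl
        · rw [G.pathDart_in v₀ _ h] at h2
          change x = _ at h
          exact absurd h2.symm (hb d' (by rw [h]; rfl))
    · push Not at hb
      obtain ⟨d', hd', rfl⟩ := hb
      obtain ⟨y, rfl⟩ : ∃ y, x = d' :: y := by
        cases x with
        | nil => simp at hd'
        | cons c y => simp at hd'; exact ⟨y, by rw [hd']⟩
      refine ⟨⟨(⟨d' :: y, hx⟩, ⟨y, hx.2.2⟩), Or.inr ⟨d', rfl⟩⟩, ⟨rfl, ?_⟩, ?_⟩
      · exact G.pathDart_in v₀ _ rfl
      · rintro ⟨⟨x', y'⟩, hadj⟩ ⟨h1, h2⟩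
        change x' = _ at h1
        subst h1
        rcases id hadj with ⟨c, h⟩ | ⟨c, h⟩
        · rw [G.pathDart_out v₀ _ h] at h2
          have h3 := y'.2
          rw [h] at h3
          exact absurd h2 (h3.2.1 d' rfl)
        · have : y' = ⟨y, hx.2.2⟩ := Subtype.ext (List.cons.inj h).2.symm
          subst this
          rfl

end MGraph

/-- Vertices and directed edges of a connected graph have lifts to any universal cover. -/
theorem UniversalCover.exists_lifts {V D X : Type*} {G : MGraph V D} (hG : G.Connected)
    (C : UniversalCover G X) : (∀ u, ∃ x, C.proj x = u) ∧ ∀ d, ∃ e, C.dartProj e = d := by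
  have hV : ∀ u, ∃ x, C.proj x = u := by
    intro u
    obtain ⟨x₀⟩ := C.isTree.connected.nonempty
    induction hG.2 (C.proj x₀) u with
    | refl => exact ⟨x₀, rfl⟩
    | tail _ h ih =>
      obtain ⟨x, hx⟩ := ih
      obtain ⟨d, h1, h2⟩ := h
      obtain ⟨e, ⟨-, he⟩, -⟩ := C.existsUnique_lift x d (h1.trans hx.symm)
      refine ⟨e.symm.fst, ?_⟩
      rw [← C.src_dartProj, C.dartProj_symm, he]
      exact h2
  refine ⟨hV, fun d => ?_⟩
  obtain ⟨x, hx⟩ := hV (G.src d)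
  obtain ⟨e, ⟨-, he⟩, -⟩ := C.existsUnique_lift x d hx.symm
  exact ⟨e, he⟩

/-! ### Bounded operators given by infinite matrices -/

/-- The Hilbert space `ℓ²(ι)` over the complex numbers. -/
abbrev L2 (ι : Type*) := lp (fun _ : ι => ℂ) 2

/-- The absolute row sums and column sums of the matrix `A` are bounded by a constant. -/
def SchurBounded {ι : Type*} (A : ι → ι → ℝ) : Prop :=
  ∃ C : NNReal, (∀ i, ∑' j, ‖A i j‖ₑ ≤ C) ∧ ∀ j, ∑' i, ‖A i j‖ₑ ≤ C

theorem SchurBounded.submatrix {ι κ : Type*} {A : ι → ι → ℝ} (hA : SchurBounded A)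
    {f : κ → ι} (hf : Function.Injective f) : SchurBounded (fun i j => A (f i) (f j)) := by
  obtain ⟨C, h1, h2⟩ := hA
  exact ⟨C, fun i => (ENNReal.tsum_comp_le_tsum_of_injective hf _).trans (h1 (f i)),
    fun j => (ENNReal.tsum_comp_le_tsum_of_injective hf (fun i => ‖A i (f j)‖ₑ)).trans (h2 (f j))⟩

theorem ennreal_tsum_mul_sq_le {ι : Type*} (a f : ι → ℝ≥0∞) :
    (∑' j, a j * f j) ^ 2 ≤ (∑' j, a j) * ∑' j, a j * f j ^ 2 := by
  have key : ∀ s : Finset ι, (∑ j ∈ s, a j * f j) ^ 2 ≤ (∑' j, a j) * ∑' j, a j * f j ^ 2 := by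
    intro s
    have h := ENNReal.inner_le_Lp_mul_Lq s (fun j => a j ^ (1 / 2 : ℝ))
      (fun j => a j ^ (1 / 2 : ℝ) * f j) Real.HolderConjugate.two_two
    have e1 : ∀ j, a j ^ (1 / 2 : ℝ) * (a j ^ (1 / 2 : ℝ) * f j) = a j * f j := by
      intro j
      rw [← mul_assoc, ← ENNReal.rpow_add_of_nonneg _ _ (by norm_num) (by norm_num)]
      norm_num
    have e2 : ∀ j, (a j ^ (1 / 2 : ℝ)) ^ (2 : ℝ) = a j := by
      intro j
      rw [← ENNReal.rpow_mul]; norm_num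
    have e3 : ∀ j, (a j ^ (1 / 2 : ℝ) * f j) ^ (2 : ℝ) = a j * f j ^ 2 := by
      intro j
      rw [ENNReal.mul_rpow_of_nonneg _ _ (by norm_num), e2]
      norm_num
    simp only [e1, e2, e3] at h
    have h2 := pow_le_pow_left' h 2
    rw [mul_pow] at h2
    have e4 : ∀ x : ℝ≥0∞, (x ^ (1 / 2 : ℝ)) ^ 2 = x := by
      intro x
      rw [← ENNReal.rpow_natCast, ← ENNReal.rpow_mul]; norm_num
    rw [e4, e4] at h2
    exact h2.trans (mul_le_mul' (ENNReal.sum_le_tsum s) (ENNReal.sum_le_tsum s))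
  have hl : Filter.Tendsto (fun s : Finset ι => (∑ j ∈ s, a j * f j) ^ 2) Filter.atTop
      (𝓝 ((∑' j, a j * f j) ^ 2)) :=
    (ENNReal.continuous_pow 2).continuousAt.tendsto.comp ENNReal.summable.hasSum
  exact le_of_tendsto' hl key

theorem schur_estimate {ι : Type*} {A : ι → ι → ℝ} {C : NNReal}
    (h1 : ∀ i, ∑' j, ‖A i j‖ₑ ≤ C) (h2 : ∀ j, ∑' i, ‖A i j‖ₑ ≤ C) (f : ι → ℂ) :
    ∑' i, ‖∑' j, (A i j : ℂ) * f j‖ₑ ^ 2 ≤ (C : ℝ≥0∞) ^ 2 * ∑' j, ‖f j‖ₑ ^ 2 := by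
  have hn : ∀ i j, ‖(A i j : ℂ) * f j‖ₑ = ‖A i j‖ₑ * ‖f j‖ₑ := by
    intro i j
    rw [enorm_mul]
    congr 1
    simp [enorm_eq_nnnorm]
  calc ∑' i, ‖∑' j, (A i j : ℂ) * f j‖ₑ ^ 2
      ≤ ∑' i, C * ∑' j, ‖A i j‖ₑ * ‖f j‖ₑ ^ 2 := by
        refine ENNReal.tsum_le_tsum fun i => ?_
        calc ‖∑' j, (A i j : ℂ) * f j‖ₑ ^ 2 ≤ (∑' j, ‖A i j‖ₑ * ‖f j‖ₑ) ^ 2 := by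
              refine pow_le_pow_left' ?_ 2
              refine enorm_tsum_le_tsum_enorm.trans_eq ?_
              simp only [hn]
          _ ≤ _ := (ennreal_tsum_mul_sq_le _ _).trans (mul_le_mul' (h1 i) le_rfl)
    _ = C * ∑' j, (∑' i, ‖A i j‖ₑ) * ‖f j‖ₑ ^ 2 := by
        rw [ENNReal.tsum_mul_left, ENNReal.tsum_comm]
        simp only [ENNReal.tsum_mul_right]
    _ ≤ C * ∑' j, C * ‖f j‖ₑ ^ 2 :=
        mul_le_mul' le_rfl (ENNReal.tsum_le_tsum fun j => mul_le_mul' (h2 j) le_rfl)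
    _ = _ := by rw [ENNReal.tsum_mul_left, ← mul_assoc, sq]

theorem enorm_sq_tsum_L2 {ι : Type*} (f : L2 ι) :
    ∑' j, ‖f j‖ₑ ^ 2 = ENNReal.ofReal (‖f‖ ^ 2) := by
  have h := lp.norm_rpow_eq_tsum (p := 2) (by norm_num) f
  have hs := (lp.memℓp f).summable (by norm_num)
  simp only [ENNReal.toReal_ofNat, Real.rpow_ofNat] at h hs
  rw [h, ENNReal.ofReal_tsum_of_nonneg (fun _ => by positivity) hs]
  congr 1
  ext j
  rw [ENNReal.ofReal_pow (norm_nonneg _), ofReal_norm]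

theorem memL2_of_tsum {ι : Type*} {g : ι → ℂ} (h : ∑' j, ‖g j‖ₑ ^ 2 ≠ ∞) :
    Memℓp g 2 := by
  refine memℓp_gen ?_
  simp only [ENNReal.toReal_ofNat, Real.rpow_ofNat]
  have := ENNReal.summable_toReal h
  simpa using this

theorem schur_memL2 {ι : Type*} {A : ι → ι → ℝ} (hA : SchurBounded A) (f : L2 ι) :
    Memℓp (fun i => ∑' j, (A i j : ℂ) * f j) 2 := by
  obtain ⟨C, h1, h2⟩ := hA
  refine memL2_of_tsum (ne_top_of_le_ne_top ?_ (schur_estimate h1 h2 f))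
  rw [enorm_sq_tsum_L2]
  exact ENNReal.mul_ne_top (by simp) ENNReal.ofReal_ne_top

theorem schur_summable {ι : Type*} {A : ι → ι → ℝ} (hA : SchurBounded A) (f : L2 ι) (i : ι) :
    Summable fun j => (A i j : ℂ) * f j := by
  obtain ⟨C, h1, -⟩ := hA
  have h := ENNReal.summable_toReal (ne_top_of_le_ne_top ENNReal.coe_ne_top (h1 i))
  refine Summable.of_norm_bounded (g := fun j => ‖A i j‖ * ‖f‖) ?_ fun j => ?_
  · simpa using h.mul_right ‖f‖
  · rw [norm_mul, Complex.norm_real]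
    exact mul_le_mul_of_nonneg_left (lp.norm_apply_le_norm (by norm_num) f j) (norm_nonneg _)

theorem schur_norm_le {ι : Type*} {A : ι → ι → ℝ} {C : NNReal}
    (h1 : ∀ i, ∑' j, ‖A i j‖ₑ ≤ C) (h2 : ∀ j, ∑' i, ‖A i j‖ₑ ≤ C) (f g : L2 ι)
    (hg : ∀ i, g i = ∑' j, (A i j : ℂ) * f j) : ‖g‖ ≤ C * ‖f‖ := by
  have h := schur_estimate h1 h2 f
  simp only [← hg] at h
  rw [enorm_sq_tsum_L2, enorm_sq_tsum_L2, ← ENNReal.ofReal_coe_nnreal,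
    ← ENNReal.ofReal_pow C.coe_nonneg, ← ENNReal.ofReal_mul (by positivity),
    ENNReal.ofReal_le_ofReal_iff (by positivity), ← mul_pow] at h
  exact le_of_sq_le_sq h (by positivity)

/-- The bounded operator on `ℓ²(ι)` with matrix `A`: `(A f) i = ∑ j, A i j * f j`. -/
def matrixOp {ι : Type*} (A : ι → ι → ℝ) (hA : SchurBounded A) : L2 ι →L[ℂ] L2 ι :=
  LinearMap.mkContinuousOfExistsBound
    { toFun := fun f => ⟨fun i => ∑' j, (A i j : ℂ) * f j, schur_memL2 hA f⟩
      map_add' := fun f g => by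
        ext i
        simp only [lp.coeFn_add, Pi.add_apply, mul_add]
        exact (schur_summable hA f i).tsum_add (schur_summable hA g i)
      map_smul' := fun c f => by
        ext i
        simp only [lp.coeFn_smul, Pi.smul_apply, smul_eq_mul, RingHom.id_apply]
        rw [← tsum_mul_left]
        congr 1
        ext j
        ring }
    (by
      obtain ⟨C, h1, h2⟩ := id hA
      exact ⟨C, fun f => schur_norm_le h1 h2 f _ fun _ => rfl⟩)

theorem matrixOp_apply {ι : Type*} (A : ι → ι → ℝ) (hA : SchurBounded A) (f : L2 ι) (i : ι) :
    matrixOp A hA f i = ∑' j, (A i j : ℂ) * f j := rfl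

open Classical in
/-- The unit vector `δ_i` of `ℓ²(ι)`. -/
def delta {ι : Type*} (i : ι) : L2 ι := lp.single 2 i (1 : ℂ)

/-- The diagonal matrix element `⟨δ_i, (T - z)⁻¹ δ_i⟩` of the resolvent of `T`. -/
def resolventEntry {ι : Type*} (T : L2 ι →L[ℂ] L2 ι) (i : ι) (z : ℂ) : ℂ :=
  inner ℂ (delta i) (Ring.inverse (T - z • (1 : L2 ι →L[ℂ] L2 ι)) (delta i))

/-! ### Spectral measures -/

section SpectralMeasure

open scoped CompactlySupported

variable {E : Type*} [NormedAddCommGroup E] [InnerProductSpace ℂ E] [CompleteSpace E]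

/-- The positive linear functional `f ↦ ⟨ψ, f(T) ψ⟩` on compactly supported continuous functions,
for a bounded self-adjoint operator `T` (`f(T)` is the continuous functional calculus). -/
def spectralFunctional (T : E →L[ℂ] E) (ψ : E) :
    C_c(ℝ, ℝ) →ₚ[ℝ] ℝ :=
  PositiveLinearMap.mk₀
    { toFun := fun f => (inner ℂ ψ (cfc (f : ℝ → ℝ) T ψ)).re
      map_add' := fun f g => by
        have h : cfc (⇑(f + g)) T = cfc (⇑f) T + cfc (⇑g) T :=
          cfc_add T (⇑f) (⇑g) f.continuous.continuousOn g.continuous.continuousOn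
        simp only [h, add_apply, inner_add_right, Complex.add_re]
      map_smul' := fun c f => by
        have h : cfc (⇑(c • f)) T = c • cfc (⇑f) T :=
          cfc_smul c (⇑f) T f.continuous.continuousOn
        simp only [h, smul_apply, inner_smul_right_eq_smul, RingHom.id_apply,
          Complex.smul_re] }
    (fun f hf => by
      have h : (0 : E →L[ℂ] E) ≤ cfc (⇑f) T := cfc_nonneg fun x _ => hf x
      have h2 := ((ContinuousLinearMap.nonneg_iff_isPositive _).1 h).inner_nonneg_right ψ
      exact (Complex.le_def.1 h2).1)

/-- The spectral measure of the bounded self-adjoint operator `T` at the vector `ψ`: the Borel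
measure `μ` on `ℝ` with `∫ f dμ = ⟨ψ, f(T) ψ⟩`. -/
def spectralMeasure (T : E →L[ℂ] E) (ψ : E) : MeasureTheory.Measure ℝ :=
  RealRMK.rieszMeasure (spectralFunctional T ψ)

end SpectralMeasure

/-! ### Periodic Jacobi matrices on the universal cover -/

namespace UniversalCover

variable {V D X : Type*} {G : MGraph V D} (C : UniversalCover G X) (J : JacobiParameters G)

open Classical in
/-- The infinite matrix indexed by the vertices of the tree, built from the lifted Jacobi
parameters. -/
def jacobiMatrix (x y : X) : ℝ :=
  if x = y then J.b (C.proj x)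
  else if h : C.tree.Adj x y then J.a (C.dartProj ⟨(x, y), h⟩) else 0

theorem jacobiMatrix_symm (x y : X) : C.jacobiMatrix J x y = C.jacobiMatrix J y x := by
  unfold jacobiMatrix
  by_cases h : x = y
  · subst h; rfl
  · rw [if_neg h, if_neg (Ne.symm h)]
    by_cases h2 : C.tree.Adj x y
    · rw [dif_pos h2, dif_pos h2.symm, ← J.a_inv, ← C.dartProj_symm]
      rfl
    · rw [dif_neg h2, dif_neg fun h3 => h2 h3.symm]

theorem jacobiMatrix_schurBounded [Finite V] [Finite D] : SchurBounded (C.jacobiMatrix J) := by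
  classical
  cases nonempty_fintype V
  cases nonempty_fintype D
  have key : ∀ x, ∑' y, ‖C.jacobiMatrix J x y‖ₑ ≤
      ((∑ v, ‖J.b v‖₊ + ∑ d, ‖J.a d‖₊ : NNReal) : ℝ≥0∞) := by
    intro x
    let g : X → ℝ≥0∞ := fun y =>
      if h : C.tree.Adj x y then ‖J.a (C.dartProj ⟨(x, y), h⟩)‖ₑ else 0
    have hle : ∀ y, ‖C.jacobiMatrix J x y‖ₑ ≤ (if y = x then ‖J.b (C.proj x)‖ₑ else 0) + g y := by
      intro y
      unfold jacobiMatrix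
      by_cases h : x = y
      · subst h; simp
      · rw [if_neg h, if_neg (Ne.symm h), zero_add]
        by_cases h2 : C.tree.Adj x y
        · simp [g, h2]
        · simp [h2]
    have hg : ∑' y, g y ≤ ∑' d, ‖J.a d‖ₑ := by
      have hs : Function.support g ⊆ {y | C.tree.Adj x y} := by
        intro y hy
        by_contra h
        exact hy (dif_neg h)
      rw [← tsum_subtype_eq_of_support_subset hs]
      let φ : {y | C.tree.Adj x y} → D := fun y => C.dartProj ⟨(x, y.1), y.2⟩
      have hφ : Function.Injective φ := by
        intro y y' h
        obtain ⟨e, -, hu⟩ := C.existsUnique_lift x (φ y) (C.src_dartProj _)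
        have h1 := hu ⟨(x, y.1), y.2⟩ ⟨rfl, rfl⟩
        have h2 := hu ⟨(x, y'.1), y'.2⟩ ⟨rfl, h.symm⟩
        have h3 := congrArg (fun e : C.tree.Dart => e.snd) (h1.trans h2.symm)
        exact Subtype.ext h3
      refine le_trans (le_of_eq ?_) (ENNReal.tsum_comp_le_tsum_of_injective hφ _)
      congr 1
      ext y
      exact dif_pos y.2
    calc ∑' y, ‖C.jacobiMatrix J x y‖ₑ
        ≤ ∑' y, ((if y = x then ‖J.b (C.proj x)‖ₑ else 0) + g y) := ENNReal.tsum_le_tsum hle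
      _ = ‖J.b (C.proj x)‖ₑ + ∑' y, g y := by rw [ENNReal.tsum_add, tsum_ite_eq]
      _ ≤ ∑ v, ‖J.b v‖ₑ + ∑ d, ‖J.a d‖ₑ := by
          refine add_le_add ?_ (hg.trans_eq (tsum_fintype _))
          exact Finset.single_le_sum (f := fun v => ‖J.b v‖ₑ) (fun _ _ => zero_le)
            (Finset.mem_univ _)
      _ = _ := by push_cast; rfl
  refine ⟨_, key, fun y => ?_⟩
  simp only [C.jacobiMatrix_symm J _ y]
  exact key y

/-- The vertex set of the component containing the final vertex of `e`, after the edge `e` has been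
removed from the tree. -/
def plusSide (e : C.tree.Dart) : Set X :=
  {x | (C.tree.deleteEdges {e.edge}).Reachable e.snd x}

variable [Finite V] [Finite D]

/-- The Jacobi operator `H` on `ℓ²` of the vertices of the tree. -/
def jacobiOp : L2 X →L[ℂ] L2 X := matrixOp (C.jacobiMatrix J) (C.jacobiMatrix_schurBounded J)

/-- The Green's function `⟨δ_x, (H - z)⁻¹ δ_x⟩` at a vertex `x` of the tree. -/
def green (x : X) (z : ℂ) : ℂ := resolventEntry (C.jacobiOp J) x z

/-- The Jacobi operator `H_e⁺` with the restricted Jacobi parameters on `plusSide e`. -/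
def plusOp (e : C.tree.Dart) : L2 (C.plusSide e) →L[ℂ] L2 (C.plusSide e) :=
  matrixOp (fun x y => C.jacobiMatrix J x.1 y.1)
    ((C.jacobiMatrix_schurBounded J).submatrix Subtype.val_injective)

/-- The `m`-function `⟨δ_τ(e), (H_e⁺ - z)⁻¹ δ_τ(e)⟩` of a directed edge `e` of the tree. -/
def mFun (e : C.tree.Dart) (z : ℂ) : ℂ :=
  resolventEntry (C.plusOp J e) ⟨e.snd, SimpleGraph.Reachable.refl _⟩ z

end UniversalCover

section Floquet

variable {V D X : Type*} [Fintype V] [Finite D] {G : MGraph V D} (C : UniversalCover G X)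
  (J : JacobiParameters G) (vl : V → X) (dl : D → C.tree.Dart)

/-- The density of states `dk = p⁻¹ ∑_u dμ_u`, where `p` is the number of vertices of the finite
graph and `μ_u` is the spectral measure of `H` at `δ_x` for the lift `x = vl u` of `u`. -/
def densityOfStates : MeasureTheory.Measure ℝ :=
  (Fintype.card V : ℝ≥0∞)⁻¹ • ∑ u : V, spectralMeasure (C.jacobiOp J) (delta (vl u))

/-- The Floquet function `exp (p ∫ log (t - z) dk(t))` (used for `z` in the upper half plane). -/
def floquet (z : ℂ) : ℂ :=
  Complex.exp ((Fintype.card V : ℂ) *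
    ∫ t : ℝ, Complex.log ((t : ℂ) - z) ∂(densityOfStates C J vl))

/-- `Q_e = 1 / (1 - a_e² m_e m_ě)`, the lift `dl d` of a directed edge `d` being used in `m_d`. -/
def Qfun (d : D) (z : ℂ) : ℂ :=
  1 / (1 - (J.a d : ℂ) ^ 2 * C.mFun J (dl d) z * C.mFun J (dl (G.inv d)) z)

end Floquet

/-- The eigenvalues of `T` which are isolated points of the spectrum of `T`. -/
def isolatedPointSpectrum {ι : Type*} (T : L2 ι →L[ℂ] L2 ι) : Set ℂ :=
  {w | Module.End.HasEigenvalue (T : L2 ι →ₗ[ℂ] L2 ι) w ∧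
    ∀ᶠ z in 𝓝[≠] w, z ∉ spectrum ℂ T}

/-- On the set `S`, the function `f` is an algebraic function of its argument. -/
def IsAlgebraicFunctionOn (f : ℂ → ℂ) (S : Set ℂ) : Prop :=
  ∃ P : ℂ[X][X], P ≠ 0 ∧ ∀ z ∈ S, P.evalEval z (f z) = 0

end

noncomputable section

/-! ### Resolvent entries of bounded self-adjoint operators. -/

section Resolvent

variable {ι : Type*}

/-! Write q_e = 1 - a_e² m_e m_ě. The formula says that Φ · ∏ G_u · ∏ q_e (`floquetRatio`) equals 1
on the upper half plane. This product is constant because its logarithmic derivative vanishes, and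
its limit along the imaginary axis is 1.

Removing a vertex from the tree leaves disjoint branches, so a Schur complement
(`resolventEntry_mul_schur`) gives 1/G_u = b_u - z - ∑ a_d² m_d over the directed edges d issuing
from u. The same argument inside a branch gives 1/m_c = b_τ(c) - z - ∑ a_d² m_d, now without the
reverse of c. Comparing the two gives m_ď = G_σ(d) q_d (`mFun_inv_eq`). Differentiation then yields
G_u'/G_u = G_u + ∑ a_d² m_d' G_u, while q_e'/q_e = -(a_e² m_e' G_σ(e) + a_e² m_ě' G_τ(e)). Summed
over vertices and edges, all terms with m' cancel and ∑ G_u remains. This is cancelled by Φ'/Φ = -∑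
G_u, which comes from differentiating log(t - z) under the integral. Along z = iy, Φ behaves like
(-z)^p, each G_u like -1/z, and each m_e tends to 0, which fixes the constant.

The recursion closes on the finite graph because m depends only on the projected edge
(`mFun_eq_of_dartProj_eq`). Instead of using deck transformations, this is proved by iterating the
recursion, a contraction for large Im z, followed by the identity theorem.

For the continuation, a resolvent entry has at most a simple pole at an isolated point of the
spectrum. Off the spectrum of H, a branch can have spectrum only where the Green's function at the
vertex it hangs from vanishes (`IsBranch.notMem_spectrum`). Such zeros do not accumulate in Ω,
because Green's functions are meromorphic there and have no non-real zeros.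

For algebraicity, the m_e solve a polynomial system over ℂ[z] whose Jacobian is invertible at one
point high in the half plane. Hence their Kähler differentials over ℂ(z) vanish, and they are
algebraic (`isAlgebraic_of_jacobian_over_field`). Finally Φ is a quotient of polynomials in z and
the m_e. -/

theorem isUnit_sub_smul_one_iff {T : L2 ι →L[ℂ] L2 ι} {z : ℂ} :
    IsUnit (T - z • (1 : L2 ι →L[ℂ] L2 ι)) ↔ z ∉ spectrum ℂ T := by
  rw [spectrum.notMem_iff, ← IsUnit.neg_iff, neg_sub, Algebra.algebraMap_eq_smul_one]

theorem inner_delta_left (i : ι) (f : L2 ι) : inner ℂ (delta i) f = f i := by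
  classical
  have h := lp.inner_single_left (𝕜 := ℂ) (G := fun _ : ι => ℂ) i (1 : ℂ) f
  unfold delta
  convert h using 1
  · simp

theorem delta_apply (i j : ι) [Decidable (j = i)] :
    (delta i : L2 ι) j = if j = i then 1 else 0 := by
  classical
  unfold delta
  rw [lp.coeFn_single]
  by_cases h : j = i
  · subst h; simp
  · simp [h]

theorem norm_delta (i : ι) : ‖(delta i : L2 ι)‖ = 1 := by
  classical
  unfold delta
  rw [lp.norm_single (by norm_num)]
  simp

/-- The solution of `(T - z) ψ = δ_i`. -/
def greenVector (T : L2 ι →L[ℂ] L2 ι) (i : ι) (z : ℂ) : L2 ι :=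
  Ring.inverse (T - z • (1 : L2 ι →L[ℂ] L2 ι)) (delta i)

theorem resolventEntry_eq (T : L2 ι →L[ℂ] L2 ι) (i : ι) (z : ℂ) :
    resolventEntry T i z = greenVector T i z i := inner_delta_left i _

theorem apply_greenVector {T : L2 ι →L[ℂ] L2 ι} {z : ℂ} (hz : z ∉ spectrum ℂ T) (i : ι) :
    T (greenVector T i z) - z • greenVector T i z = delta i := by
  have h := Ring.mul_inverse_cancel _ (isUnit_sub_smul_one_iff.2 hz)
  have h2 := congrArg (fun S : L2 ι →L[ℂ] L2 ι => S (delta i)) h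
  simpa [greenVector] using h2

theorem eq_smul_greenVector {T : L2 ι →L[ℂ] L2 ι} {z : ℂ} (hz : z ∉ spectrum ℂ T) {i : ι}
    {f : L2 ι} {c : ℂ} (hf : T f - z • f = c • delta i) : f = c • greenVector T i z := by
  have h := Ring.inverse_mul_cancel _ (isUnit_sub_smul_one_iff.2 hz)
  have h2 := congrArg (fun S : L2 ι →L[ℂ] L2 ι => S f) h
  simp only [mul_apply_eq_comp, sub_apply, smul_apply, one_apply_eq_self, hf, map_smul] at h2
  exact h2.symm

theorem IsSelfAdjoint.notMem_spectrum {T : L2 ι →L[ℂ] L2 ι} (hT : IsSelfAdjoint T) {z : ℂ}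
    (hz : z.im ≠ 0) : z ∉ spectrum ℂ T := by
  intro h
  rw [hT.mem_spectrum_eq_re h] at hz
  exact hz (Complex.ofReal_im _)

theorem IsSelfAdjoint.inner_apply_self_im {T : L2 ι →L[ℂ] L2 ι} (hT : IsSelfAdjoint T)
    (f : L2 ι) : (inner ℂ f (T f)).im = 0 := by
  have h1 : inner ℂ (T f) f = inner ℂ f (T f) := by
    rw [← ContinuousLinearMap.adjoint_inner_right, hT.adjoint_eq]
  have h2 := inner_conj_symm (𝕜 := ℂ) (T f) f
  rw [h1] at h2
  exact Complex.conj_eq_iff_im.1 h2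

/-- Pair T f = δ_i + z f with the Green vector f and take imaginary parts: the left side becomes
real. The resolvent bound and the non-vanishing of resolvent entries both follow from this identity.
-/
theorem resolventEntry_im {T : L2 ι →L[ℂ] L2 ι} (hT : IsSelfAdjoint T) {z : ℂ}
    (hz : z ∉ spectrum ℂ T) (i : ι) :
    (resolventEntry T i z).im = z.im * ‖greenVector T i z‖ ^ 2 := by
  set f := greenVector T i z with hf
  have h1 := hT.inner_apply_self_im f
  have h2 : T f = delta i + z • f := by rw [← apply_greenVector hz i]; simp [hf]
  rw [h2, inner_add_right, inner_smul_right, inner_self_eq_norm_sq_to_K,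
    ← inner_conj_symm, inner_delta_left] at h1
  rw [resolventEntry_eq, ← hf]
  have h3 : (z * ((‖f‖ : ℝ) : ℂ) ^ 2).im = z.im * ‖f‖ ^ 2 := by
    rw [← Complex.ofReal_pow, mul_comm, Complex.im_ofReal_mul]
    ring
  simp only [Complex.add_im, Complex.conj_im, Complex.coe_algebraMap] at h1
  have h4 : (z * ((‖f‖ : ℝ) : ℂ) ^ 2).im = (f i).im := by linarith [h1]
  linarith

theorem greenVector_ne_zero {T : L2 ι →L[ℂ] L2 ι} {z : ℂ}
    (hz : z ∉ spectrum ℂ T) (i : ι) : greenVector T i z ≠ 0 := by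
  intro h
  have h1 := apply_greenVector hz i
  rw [h] at h1
  have h2 := norm_delta i
  rw [← h1] at h2
  simp at h2

theorem norm_resolventEntry_le_greenVector (T : L2 ι →L[ℂ] L2 ι) (i : ι) (z : ℂ) :
    ‖resolventEntry T i z‖ ≤ ‖greenVector T i z‖ := by
  rw [resolventEntry_eq]
  exact lp.norm_apply_le_norm (by norm_num) _ i

/-- By `resolventEntry_im`, |Im z| ‖f‖² is at most the modulus of one entry of f, hence at most ‖f‖.
-/
theorem norm_greenVector_le {T : L2 ι →L[ℂ] L2 ι} (hT : IsSelfAdjoint T) {z : ℂ}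
    (hz : z.im ≠ 0) (i : ι) : ‖greenVector T i z‖ ≤ |z.im|⁻¹ := by
  have hz' := hT.notMem_spectrum hz
  have h1 := resolventEntry_im hT hz' i
  have h2 := (Complex.abs_im_le_norm _).trans (norm_resolventEntry_le_greenVector T i z)
  have h3 : 0 < ‖greenVector T i z‖ := norm_pos_iff.2 (greenVector_ne_zero hz' i)
  rw [h1, abs_mul, abs_of_nonneg (sq_nonneg ‖_‖)] at h2
  rw [← one_div, le_div_iff₀ (abs_pos.2 hz)]
  nlinarith

theorem norm_resolventEntry_le {T : L2 ι →L[ℂ] L2 ι} (hT : IsSelfAdjoint T) {z : ℂ}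
    (hz : z.im ≠ 0) (i : ι) : ‖resolventEntry T i z‖ ≤ |z.im|⁻¹ :=
  (norm_resolventEntry_le_greenVector T i z).trans (norm_greenVector_le hT hz i)

theorem resolventEntry_im_mul_pos {T : L2 ι →L[ℂ] L2 ι} (hT : IsSelfAdjoint T) {z : ℂ}
    (hz : z.im ≠ 0) (i : ι) : 0 < (resolventEntry T i z).im * z.im := by
  have hz' := hT.notMem_spectrum hz
  rw [resolventEntry_im hT hz' i]
  have := norm_pos_iff.2 (greenVector_ne_zero hz' i)
  have h2 : 0 < z.im ^ 2 := by positivity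
  nlinarith [pow_pos this 2, mul_pos h2 (pow_pos this 2)]

theorem resolventEntry_ne_zero {T : L2 ι →L[ℂ] L2 ι} (hT : IsSelfAdjoint T) {z : ℂ}
    (hz : z.im ≠ 0) (i : ι) : resolventEntry T i z ≠ 0 := by
  intro h
  have := resolventEntry_im_mul_pos hT hz i
  simp [h] at this

/-- The quantity 1 + zG is the entry of T f at i. The bound gives the asymptotics G ~ -1/z. -/
theorem norm_one_add_mul_resolventEntry_le {T : L2 ι →L[ℂ] L2 ι} (hT : IsSelfAdjoint T) {z : ℂ}
    (hz : z.im ≠ 0) (i : ι) : ‖1 + z * resolventEntry T i z‖ ≤ ‖T‖ * |z.im|⁻¹ := by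
  have h1 := apply_greenVector (hT.notMem_spectrum hz) i
  have h2 := congrArg (inner ℂ (delta i : L2 ι)) h1
  rw [inner_sub_right, inner_smul_right, inner_self_eq_norm_sq_to_K, norm_delta, inner_delta_left,
    inner_delta_left, ← resolventEntry_eq] at h2
  have h3 : 1 + z * resolventEntry T i z = T (greenVector T i z) i := by
    simp at h2
    linear_combination -h2
  rw [h3]
  refine (lp.norm_apply_le_norm (by norm_num) _ i).trans ((T.le_opNorm _).trans ?_)
  exact mul_le_mul_of_nonneg_left (norm_greenVector_le hT hz i) (norm_nonneg _)

theorem differentiableAt_resolventEntry {T : L2 ι →L[ℂ] L2 ι} {z : ℂ}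
    (hz : z ∉ spectrum ℂ T) (i : ι) : DifferentiableAt ℂ (resolventEntry T i) z := by
  have h1 : DifferentiableAt ℂ (fun z : ℂ => T - z • (1 : L2 ι →L[ℂ] L2 ι)) z := by fun_prop
  have h2 := (differentiableAt_inverse (𝕜 := ℂ) (isUnit_sub_smul_one_iff.2 hz)).comp z h1
  have h3 : DifferentiableAt ℂ
      (fun z : ℂ => Ring.inverse (T - z • (1 : L2 ι →L[ℂ] L2 ι)) (delta i)) z :=
    h2.clm_apply (differentiableAt_const _)
  exact (innerSL ℂ (delta i)).differentiableAt.comp z h3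

theorem analyticOnNhd_resolventEntry {T : L2 ι →L[ℂ] L2 ι} (hT : IsSelfAdjoint T) (i : ι) :
    AnalyticOnNhd ℂ (resolventEntry T i) {z | 0 < z.im} := by
  refine DifferentiableOn.analyticOnNhd (fun z hz => ?_) (isOpen_lt continuous_const
    Complex.continuous_im)
  exact (differentiableAt_resolventEntry (hT.notMem_spectrum (ne_of_gt hz)) i).differentiableWithinAt

/-- The inverse is the continuous functional calculus of (w - z)⁻¹, whose norm is controlled by its
supremum over the spectrum. -/
theorem norm_inverse_sub_smul_one_le {T : L2 ι →L[ℂ] L2 ι} (hT : IsSelfAdjoint T) {z : ℂ}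
    {r : ℝ} (hr : 0 < r) (h : ∀ w ∈ spectrum ℂ T, r ≤ ‖w - z‖) :
    ‖Ring.inverse (T - z • (1 : L2 ι →L[ℂ] L2 ι))‖ ≤ r⁻¹ := by
  have hne : ∀ w ∈ spectrum ℂ T, w - z ≠ 0 := fun w hw h0 => by
    have := h w hw
    rw [h0, norm_zero] at this
    linarith
  have hN : IsStarNormal T := hT.isStarNormal
  have h1 : cfc (fun w : ℂ => w - z) T = T - z • (1 : L2 ι →L[ℂ] L2 ι) := by
    rw [cfc_sub (fun w : ℂ => w) (fun _ => z) T, cfc_id' ℂ T, cfc_const z T,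
      Algebra.algebraMap_eq_smul_one]
  have h2 := cfc_inv (fun w : ℂ => w - z) T hne
  rw [h1] at h2
  rw [← h2]
  refine norm_cfc_le (by positivity) fun w hw => ?_
  rw [norm_inv]
  exact inv_anti₀ hr (h w hw)

/-- Near an isolated point w of the spectrum the resolvent is bounded by 1/|z - w|, so (z - w) G has
a removable singularity. -/
theorem meromorphicAt_resolventEntry {T : L2 ι →L[ℂ] L2 ι} (hT : IsSelfAdjoint T) (i : ι) {w : ℂ}
    (hw : ∀ᶠ z in 𝓝[≠] w, z ∉ spectrum ℂ T) : MeromorphicAt (resolventEntry T i) w := by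
  obtain ⟨ε, hε, hb⟩ := Metric.mem_nhdsWithin_iff.1 hw
  have hs : Metric.ball w (ε / 2) ∈ 𝓝 w := Metric.ball_mem_nhds _ (by positivity)
  set f : ℂ → ℂ := fun z => (z - w) * resolventEntry T i z with hf
  have hd : DifferentiableOn ℂ f (Metric.ball w (ε / 2) \ {w}) := by
    intro z hz
    refine DifferentiableAt.differentiableWithinAt ?_
    refine (by fun_prop : DifferentiableAt ℂ (fun z => z - w) z).mul
      (differentiableAt_resolventEntry (hb ⟨?_, hz.2⟩) i)
    exact Metric.ball_subset_ball (by linarith) hz.1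
  have hbd : ∀ z ∈ Metric.ball w (ε / 2) \ {w}, ‖f z‖ ≤ 1 := by
    intro z hz
    have hzw : 0 < ‖z - w‖ := norm_pos_iff.2 (sub_ne_zero.2 hz.2)
    have hzε : ‖z - w‖ < ε / 2 := by simpa [dist_eq_norm] using hz.1
    -- The radius ε/2 makes w the spectral point nearest to z: any other one is at distance at least
    -- ε from w, hence more than ε/2 from z.
    have h1 := norm_inverse_sub_smul_one_le hT hzw (z := z) fun t ht => by
      by_cases htw : t = w
      · rw [htw, norm_sub_rev]
      · have h2 : ε ≤ ‖t - w‖ := by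
          by_contra h3
          push Not at h3
          exact hb ⟨by simpa [dist_eq_norm] using h3, htw⟩ ht
        have h4 : ‖t - w‖ ≤ ‖t - z‖ + ‖z - w‖ := by
          simpa using norm_add_le (t - z) (z - w)
        linarith
    have h5 : ‖greenVector T i z‖ ≤ ‖z - w‖⁻¹ := by
      refine (ContinuousLinearMap.le_opNorm _ _).trans ?_
      rw [norm_delta, mul_one]
      exact h1
    rw [hf, norm_mul]
    have h6 := (norm_resolventEntry_le_greenVector T i z).trans h5
    calc _ ≤ ‖z - w‖ * ‖z - w‖⁻¹ := mul_le_mul_of_nonneg_left h6 hzw.le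
      _ = 1 := mul_inv_cancel₀ hzw.ne'
  have h7 := Complex.differentiableOn_update_limUnder_of_bddAbove hs hd
    ⟨1, by rintro _ ⟨z, hz, rfl⟩; exact hbd z hz⟩
  have h8 := (h7.analyticAt hs).meromorphicAt
  have h9 : MeromorphicAt (fun z => (z - w)⁻¹ * Function.update f w (Filter.limUnder (𝓝[≠] w) f) z) w :=
    MeromorphicAt.mul (by fun_prop) h8
  refine h9.congr ?_
  filter_upwards [self_mem_nhdsWithin] with z hz
  rw [Function.update_of_ne hz, hf]
  have : z - w ≠ 0 := sub_ne_zero.2 hz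
  field_simp

theorem frequently_im_ne_zero (w : ℂ) : ∃ᶠ z in 𝓝[≠] w, z.im ≠ 0 := by
  rw [Filter.frequently_iff]
  intro U hU
  obtain ⟨ε, hε, hb⟩ := Metric.mem_nhdsWithin_iff.1 hU
  by_cases hw : w.im = 0
  · refine ⟨w + (ε / 2 : ℝ) * Complex.I, hb ⟨?_, ?_⟩, ?_⟩
    · simp [abs_of_pos hε, hε]
    · simp [hε.ne']
    · simp [hw, hε.ne']
  · refine ⟨w + (ε / 2 : ℝ), hb ⟨?_, ?_⟩, ?_⟩
    · simp [abs_of_pos hε, hε]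
    · simp [hε.ne']
    · simpa using hw

/-- Non-real points accumulate at every w, so the function cannot vanish identically on a punctured
neighborhood. -/
theorem MeromorphicAt.eventually_ne_zero_of_im {f : ℂ → ℂ} {w : ℂ} (hf : MeromorphicAt f w)
    (h : ∀ z : ℂ, z.im ≠ 0 → f z ≠ 0) : ∀ᶠ z in 𝓝[≠] w, f z ≠ 0 := by
  refine hf.eventually_eq_zero_or_eventually_ne_zero.resolve_left fun h0 => ?_
  obtain ⟨z, hz, hz0⟩ := ((frequently_im_ne_zero w).and_eventually h0).exists
  exact h z hz hz0

end Resolvent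

/-! ### Matrices with branches and Schur complements. -/

section MatrixOp

variable {ι κ : Type*}

theorem matrixOp_delta {A : ι → ι → ℝ} (hA : SchurBounded A) (i j : ι) :
    matrixOp A hA (delta i) j = A j i := by
  classical
  rw [matrixOp_apply, tsum_eq_single i]
  · simp [delta_apply]
  · intro k hk
    simp [delta_apply, hk]

theorem isSelfAdjoint_matrixOp {A : ι → ι → ℝ} (hA : SchurBounded A)
    (hs : ∀ i j, A i j = A j i) : IsSelfAdjoint (matrixOp A hA) := by
  rw [ContinuousLinearMap.isSelfAdjoint_iff']
  ext f i
  rw [← inner_delta_left, ContinuousLinearMap.adjoint_inner_right, lp.inner_eq_tsum,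
    matrixOp_apply]
  congr 1
  ext j
  rw [matrixOp_delta, hs j i, RCLike.inner_apply, Complex.conj_ofReal, mul_comm]

/-- The restriction of a square summable function along an injective map. -/
def L2.comap (f : κ → ι) (hf : Function.Injective f) (ψ : L2 ι) : L2 κ :=
  ⟨fun k => ψ (f k), memL2_of_tsum (ne_top_of_le_ne_top
    (by rw [enorm_sq_tsum_L2 ψ]; exact ENNReal.ofReal_ne_top)
    (ENNReal.tsum_comp_le_tsum_of_injective hf fun i => ‖ψ i‖ₑ ^ 2))⟩

theorem L2.comap_apply (f : κ → ι) (hf : Function.Injective f) (ψ : L2 ι) (k : κ) :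
    L2.comap f hf ψ k = ψ (f k) := rfl

theorem L2.exists_comap_eq (f : κ → ι) (hf : Function.Injective f) (φ : L2 κ) :
    ∃ ψ : L2 ι, ∀ k, ψ (f k) = φ k := by
  classical
  have hv : ∀ k, Function.extend f φ 0 (f k) = φ k := fun k => hf.extend_apply _ _ k
  refine ⟨⟨Function.extend f φ 0, memL2_of_tsum ?_⟩, hv⟩
  rw [← hf.tsum_eq (f := fun i => ‖Function.extend f φ 0 i‖ₑ ^ 2)]
  · simp only [hv]
    rw [enorm_sq_tsum_L2 φ]
    exact ENNReal.ofReal_ne_top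
  · intro i hi
    by_contra h
    exact hi (by simp [Function.extend_apply' _ _ _ h])

/-- The restriction of the matrix `A` to the range of `f`, which is linked to the complement only
by the entry `a` between `f r` and `x`. -/
structure IsBranch (A : ι → ι → ℝ) (f : κ → ι) (x : ι) (r : κ) (a : ℝ) : Prop where
  injective : Function.Injective f
  ne : ∀ k, f k ≠ x
  link : A (f r) x = a
  off : ∀ k j, j ∉ Set.range f → (j ≠ x ∨ k ≠ r) → A (f k) j = 0

open Classical in
-- Split the row sum into the branch and its complement. Outside the branch only the column x can
-- contribute, and only in the row of the root r.
theorem IsBranch.matrixOp_apply {A : ι → ι → ℝ} {f : κ → ι} {x : ι} {r : κ} {a : ℝ}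
    (h : IsBranch A f x r a) (hA : SchurBounded A) (ψ : L2 ι) (k : κ) :
    matrixOp A hA ψ (f k) =
      matrixOp (fun i j => A (f i) (f j)) (hA.submatrix h.injective) (L2.comap f h.injective ψ) k +
        (a * ψ x) * (delta r : L2 κ) k := by
  rw [_root_.matrixOp_apply, _root_.matrixOp_apply,
    ← (schur_summable hA ψ (f k)).tsum_subtype_add_tsum_subtype_compl (Set.range f),
    tsum_range (fun j => (A (f k) j : ℂ) * ψ j) h.injective]
  congr 1
  have hx : x ∉ Set.range f := fun ⟨k, hk⟩ => h.ne k hk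
  rw [tsum_eq_single ⟨x, hx⟩]
  · rw [delta_apply]
    split_ifs with hk
    · rw [hk, h.link, mul_one]
    · rw [h.off k x hx (Or.inr hk)]; simp
  · rintro ⟨j, hj⟩ hne
    rw [h.off k j hj (Or.inl fun h0 => hne (Subtype.ext h0))]
    simp

theorem IsBranch.matrixOp_sub_apply {A : ι → ι → ℝ} {f : κ → ι} {x : ι} {r : κ} {a : ℝ}
    (h : IsBranch A f x r a) (hA : SchurBounded A) (ψ : L2 ι) (z : ℂ) (k : κ) :
    (matrixOp A hA ψ - z • ψ) (f k) =
      (matrixOp (fun i j => A (f i) (f j)) (hA.submatrix h.injective) (L2.comap f h.injective ψ) -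
        z • L2.comap f h.injective ψ + (a * ψ x) • delta r) k := by
  simp only [lp.coeFn_sub, lp.coeFn_add, lp.coeFn_smul, Pi.sub_apply, Pi.add_apply, Pi.smul_apply,
    smul_eq_mul, h.matrixOp_apply hA ψ k, L2.comap_apply]
  ring

/-- The Schur complement formula for a vertex `x` whose removal leaves the branches `f n`. -/
theorem resolventEntry_mul_schur {N : Type*} [Fintype N] {κ : N → Type*} {A : ι → ι → ℝ}
    (hA : SchurBounded A) {f : ∀ n, κ n → ι} {x : ι} {r : ∀ n, κ n} {a : N → ℝ}
    (h : ∀ n, IsBranch A (f n) x (r n) (a n)) (hs : ∀ i j, A i j = A j i)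
    (hrow : ∀ j, j ≠ x → A x j ≠ 0 → ∃ n, f n (r n) = j)
    (hinj : Function.Injective fun n => f n (r n)) {z : ℂ}
    (hz : z ∉ spectrum ℂ (matrixOp A hA))
    (hzn : ∀ n, z ∉ spectrum ℂ (matrixOp (fun i j => A (f n i) (f n j))
      (hA.submatrix (h n).injective))) :
    resolventEntry (matrixOp A hA) x z * (A x x - z - ∑ n, (a n : ℂ) ^ 2 *
      resolventEntry (matrixOp (fun i j => A (f n i) (f n j)) (hA.submatrix (h n).injective))
        (r n) z) = 1 := by
  classical
  set ψ := greenVector (matrixOp A hA) x z with hψ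
  have h1 : matrixOp A hA ψ - z • ψ = delta x := apply_greenVector hz x
  have h2 : ∀ n, ψ (f n (r n)) = -(a n * ψ x) *
      resolventEntry (matrixOp (fun i j => A (f n i) (f n j)) (hA.submatrix (h n).injective))
        (r n) z := by
    intro n
    -- On the branch, ψ solves the branch equation with source -(a ψ(x)) δ_r, so it is a multiple of
    -- the branch's Green vector.
    have h3 := eq_smul_greenVector (hzn n) (i := r n) (f := L2.comap (f n) (h n).injective ψ)
      (c := -(a n * ψ x)) (by
        rw [neg_smul, ← add_eq_zero_iff_eq_neg]
        ext k
        rw [← (h n).matrixOp_sub_apply hA, h1, delta_apply, if_neg ((h n).ne k)]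
        rfl)
    have h4 := congrArg (fun g : L2 (κ n) => g (r n)) h3
    simpa only [L2.comap_apply, lp.coeFn_smul, Pi.smul_apply, smul_eq_mul,
      ← resolventEntry_eq] using h4
  have h5 : matrixOp A hA ψ x = A x x * ψ x + ∑ n, (a n : ℂ) * ψ (f n (r n)) := by
    -- `none` stands for x and `some n` for the root of branch n; these indices carry the whole row
    -- of x.
    let g : Option N → ι := fun o => o.elim x fun n => f n (r n)
    have hg : Function.Injective g := by
      rintro (_ | n) (_ | n') hn
      · rfl
      · exact absurd hn.symm ((h n').ne _)
      · exact absurd hn ((h n).ne _)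
      · exact congrArg some (hinj hn)
    rw [matrixOp_apply, ← hg.tsum_eq, tsum_fintype, Fintype.sum_option]
    · congr 1
      refine Finset.sum_congr rfl fun n _ => ?_
      change (A x (f n (r n)) : ℂ) * _ = _
      rw [hs, (h n).link]
      rfl
    · intro j hj
      by_cases hjx : j = x
      · exact ⟨none, hjx.symm⟩
      · obtain ⟨n, hn⟩ := hrow j hjx fun h0 => hj (by simp [h0])
        exact ⟨some n, hn⟩
  have h6 := congrArg (fun g : L2 ι => g x) h1
  simp only [lp.coeFn_sub, lp.coeFn_smul, Pi.sub_apply, Pi.smul_apply, smul_eq_mul, h5, h2,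
    delta_apply, if_true] at h6
  rw [resolventEntry_eq, ← hψ, ← h6, mul_sub, mul_sub, Finset.mul_sum,
    add_sub_right_comm, sub_eq_add_neg, ← Finset.sum_neg_distrib]
  congr 1
  · ring
  · exact Finset.sum_congr rfl fun n _ => by ring

/-- A branch at `x` has no spectrum at `z` if the whole matrix has none and the Green's function at
`x` does not vanish. -/
theorem IsBranch.notMem_spectrum {A : ι → ι → ℝ} {f : κ → ι} {x : ι} {r : κ} {a : ℝ}
    (h : IsBranch A f x r a) (hA : SchurBounded A) (hs : ∀ i j, A i j = A j i) {z : ℂ}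
    (hz : z ∉ spectrum ℂ (matrixOp A hA)) (hG : resolventEntry (matrixOp A hA) x z ≠ 0) :
    z ∉ spectrum ℂ (matrixOp (fun i j => A (f i) (f j)) (hA.submatrix h.injective)) := by
  classical
  set T := matrixOp (fun i j => A (f i) (f j)) (hA.submatrix h.injective) with hT
  have hTs : IsSelfAdjoint T := isSelfAdjoint_matrixOp _ fun i j => hs _ _
  by_cases him : z.im = 0
  swap
  · exact hTs.notMem_spectrum him
  have hsurj : ∀ φ : L2 κ, ∃ ψ, T ψ - z • ψ = φ := by
    intro φ
    obtain ⟨φ', hφ'⟩ := L2.exists_comap_eq f h.injective φ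
    obtain ⟨u, hu⟩ : ∃ u, matrixOp A hA u - z • u = φ' := by
      have h1 := Ring.mul_inverse_cancel _ (isUnit_sub_smul_one_iff.2 hz)
      have h2 := congrArg (fun S : L2 ι →L[ℂ] L2 ι => S φ') h1
      exact ⟨_, by simpa using h2⟩
    set g := greenVector (matrixOp A hA) x z with hg
    have hgx : g x ≠ 0 := by rwa [resolventEntry_eq] at hG
    -- Subtracting this multiple of the Green vector makes v vanish at x, which decouples the
    -- branch. The cost is a source at x, invisible from the branch.
    set v := u - (u x / g x) • g with hv
    have hvx : v x = 0 := by
      simp only [hv, lp.coeFn_sub, lp.coeFn_smul, Pi.sub_apply, Pi.smul_apply, smul_eq_mul]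
      field_simp
      simp
    have hvv : matrixOp A hA v - z • v = φ' - (u x / g x) • delta x := by
      rw [← hu, ← apply_greenVector hz x, ← hg, hv, map_sub, map_smul]
      module
    refine ⟨L2.comap f h.injective v, ?_⟩
    ext k
    have h3 := h.matrixOp_sub_apply hA v z k
    rw [hvx, mul_zero, zero_smul, add_zero, hvv] at h3
    rw [hT, ← h3]
    simp only [lp.coeFn_sub, lp.coeFn_smul, Pi.sub_apply, Pi.smul_apply, delta_apply,
      if_neg (h.ne k), hφ', smul_zero, sub_zero]
  rw [← isUnit_sub_smul_one_iff, ContinuousLinearMap.isUnit_iff_bijective]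
  -- As z is real here, T - z is self-adjoint, so its kernel is orthogonal to its range and
  -- surjectivity implies injectivity.
  have hS : IsSelfAdjoint (T - z • (1 : L2 κ →L[ℂ] L2 κ)) := by
    refine hTs.sub (IsSelfAdjoint.smul ?_ (IsSelfAdjoint.one _))
    exact Complex.conj_eq_iff_im.2 him
  have hsurj' : Function.Surjective (T - z • (1 : L2 κ →L[ℂ] L2 κ)) := fun φ => by
    simpa using hsurj φ
  refine ⟨(injective_iff_map_eq_zero _).2 fun v hv => ?_, hsurj'⟩
  obtain ⟨w, hw⟩ := hsurj' v
  rw [← inner_self_eq_zero (𝕜 := ℂ)]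
  nth_rewrite 2 [← hw]
  rw [← ContinuousLinearMap.adjoint_inner_left, hS.adjoint_eq, hv, inner_zero_left]

end MatrixOp

namespace UniversalCover

/-! ### Branches of the tree. -/

section Tree

variable {V D X : Type*} {G : MGraph V D} (C : UniversalCover G X)

theorem snd_mem_plusSide (e : C.tree.Dart) : e.snd ∈ C.plusSide e := SimpleGraph.Reachable.refl _

theorem fst_notMem_plusSide (e : C.tree.Dart) : e.fst ∉ C.plusSide e := by
  have h := SimpleGraph.isAcyclic_iff_forall_adj_isBridge.1 C.isTree.isAcyclic e.adj
  rw [SimpleGraph.isBridge_iff] at h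
  exact fun h2 => h (SimpleGraph.Reachable.symm h2)

/-- The removed edge is the only way out of the component, and it can be used only from its final
vertex, since in a tree it is a bridge. -/
theorem mem_plusSide_of_adj (e : C.tree.Dart) {y y' : X} (hy : y ∈ C.plusSide e)
    (h : C.tree.Adj y y') : y' ∈ C.plusSide e ∨ y = e.snd ∧ y' = e.fst := by
  by_cases he : s(y, y') = e.edge
  · rw [show e.edge = s(e.fst, e.snd) from rfl, Sym2.eq_iff] at he
    rcases he with ⟨h1, -⟩ | h1
    · exact absurd (h1 ▸ hy) (C.fst_notMem_plusSide e)
    · exact Or.inr h1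
  · left
    refine SimpleGraph.Reachable.trans hy (SimpleGraph.Adj.reachable ?_)
    rw [SimpleGraph.deleteEdges_adj]
    exact ⟨h, he⟩

/-- Follow a walk that avoids the edge of e'. To leave the side of e it would have to stand at
`e.snd`, which is `e'.fst` and lies across the cut made by e'. Hence the induction tracks membership
in both sides. -/
theorem plusSide_subset {e e' : C.tree.Dart} (h : e'.fst = e.snd) (hne : e' ≠ e.symm) :
    C.plusSide e' ⊆ C.plusSide e := by
  rintro y ⟨w⟩
  have key : ∀ (p q : X) (_ : (C.tree.deleteEdges {e'.edge}).Walk p q), p ∈ C.plusSide e' →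
      p ∈ C.plusSide e → q ∈ C.plusSide e := by
    intro p q w
    induction w with
    | nil => exact fun _ h => h
    | @cons p r q hadj _ ih =>
      intro hp' hp
      have hr' : r ∈ C.plusSide e' := SimpleGraph.Reachable.trans hp' hadj.reachable
      rw [SimpleGraph.deleteEdges_adj] at hadj
      refine ih hr' ((C.mem_plusSide_of_adj e hp hadj.1).resolve_right fun h2 => ?_)
      rw [h2.1, ← h] at hp'
      exact C.fst_notMem_plusSide e' hp'
  refine key _ _ w (C.snd_mem_plusSide e') ?_
  refine (C.mem_plusSide_of_adj e (C.snd_mem_plusSide e) (h ▸ e'.adj)).resolve_right fun h2 => ?_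
  exact hne (SimpleGraph.Dart.ext _ _ (Prod.ext h h2.2))

/-- The directed edge at `x` over `d`. -/
def liftDart (x : X) (d : D) (h : G.src d = C.proj x) : C.tree.Dart :=
  (C.existsUnique_lift x d h).choose

theorem liftDart_fst (x : X) (d : D) (h : G.src d = C.proj x) : (C.liftDart x d h).fst = x :=
  (C.existsUnique_lift x d h).choose_spec.1.1

theorem dartProj_liftDart (x : X) (d : D) (h : G.src d = C.proj x) :
    C.dartProj (C.liftDart x d h) = d :=
  (C.existsUnique_lift x d h).choose_spec.1.2

theorem eq_of_fst_of_dartProj {e e' : C.tree.Dart} (h : e.fst = e'.fst)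
    (h2 : C.dartProj e = C.dartProj e') : e = e' :=
  (C.existsUnique_lift e'.fst (C.dartProj e') (C.src_dartProj e')).unique ⟨h, h2⟩ ⟨rfl, rfl⟩

theorem proj_snd (e : C.tree.Dart) : C.proj e.snd = G.tgt (C.dartProj e) := by
  rw [MGraph.tgt, ← C.dartProj_symm, C.src_dartProj]
  rfl

end Tree

/-! ### The recursion for Green's functions and m-functions on the tree. -/

section Jacobi

variable {V D X : Type*} {G : MGraph V D} (C : UniversalCover G X) (J : JacobiParameters G)

theorem jacobiMatrix_self (x : X) : C.jacobiMatrix J x x = J.b (C.proj x) := if_pos rfl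

theorem jacobiMatrix_dart (e : C.tree.Dart) :
    C.jacobiMatrix J e.fst e.snd = J.a (C.dartProj e) := by
  rw [jacobiMatrix, if_neg e.adj.ne, dif_pos e.adj]

theorem jacobiMatrix_eq_zero {x y : X} (hne : x ≠ y) (h : ¬ C.tree.Adj x y) :
    C.jacobiMatrix J x y = 0 := by
  rw [jacobiMatrix, if_neg hne, dif_neg h]

theorem isBranch_plusSide (e : C.tree.Dart) :
    IsBranch (C.jacobiMatrix J) (Subtype.val : C.plusSide e → X) e.fst
      ⟨e.snd, C.snd_mem_plusSide e⟩ (J.a (C.dartProj e)) where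
  injective := Subtype.val_injective
  ne k h := C.fst_notMem_plusSide e (h ▸ k.2)
  link := by rw [jacobiMatrix_symm, jacobiMatrix_dart]
  off k j hj h := by
    rw [Subtype.range_val] at hj
    refine C.jacobiMatrix_eq_zero J (fun h0 => hj (h0 ▸ k.2)) fun hadj => ?_
    rcases C.mem_plusSide_of_adj e k.2 hadj with h1 | ⟨h1, h2⟩
    · exact hj h1
    · exact h.elim (fun h => h h2) fun h => h (Subtype.ext h1)

/-- This is what makes the recursion close: removing the root from a branch leaves branches of the
same kind, one for each onward edge. -/
theorem isBranch_inclusion {e e' : C.tree.Dart} (h : e'.fst = e.snd) (hne : e' ≠ e.symm) :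
    IsBranch (fun i j : C.plusSide e => C.jacobiMatrix J i.1 j.1)
      (Set.inclusion (C.plusSide_subset h hne)) ⟨e.snd, C.snd_mem_plusSide e⟩
      ⟨e'.snd, C.snd_mem_plusSide e'⟩ (J.a (C.dartProj e')) where
  injective := Set.inclusion_injective _
  ne k hk := (C.isBranch_plusSide J e').ne k (by rw [h]; exact congrArg Subtype.val hk)
  link := by rw [← (C.isBranch_plusSide J e').link, h]
  off k j hj hjk := by
    refine (C.isBranch_plusSide J e').off k j.1 ?_ ?_
    · rintro ⟨l, hl⟩
      exact hj ⟨l, Subtype.ext hl⟩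
    · rw [h]
      exact hjk.imp (fun h1 h2 => h1 (Subtype.ext h2)) id

variable [Finite V] [Finite D]

theorem isSelfAdjoint_jacobiOp : IsSelfAdjoint (C.jacobiOp J) :=
  isSelfAdjoint_matrixOp _ (C.jacobiMatrix_symm J)

theorem isSelfAdjoint_plusOp (e : C.tree.Dart) : IsSelfAdjoint (C.plusOp J e) :=
  isSelfAdjoint_matrixOp _ fun _ _ => C.jacobiMatrix_symm J _ _

theorem notMem_spectrum_plusOp (e : C.tree.Dart) {z : ℂ} (hz : z ∉ spectrum ℂ (C.jacobiOp J))
    (hG : C.green J e.fst z ≠ 0) : z ∉ spectrum ℂ (C.plusOp J e) :=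
  (C.isBranch_plusSide J e).notMem_spectrum _ (C.jacobiMatrix_symm J) hz hG

/-- The neighbors of x correspond, by unique lifting, to the directed edges of the finite graph at
the projection of x, so the Schur complement is a sum over those. -/
theorem green_mul_schur (x : X) {u : V} (hu : C.proj x = u) [Fintype {d // G.src d = u}] {z : ℂ}
    (hz : z.im ≠ 0) :
    C.green J x z * (J.b u - z - ∑ d : {d // G.src d = u}, (J.a d.1 : ℂ) ^ 2 *
      C.mFun J (C.liftDart x d.1 (d.2.trans hu.symm)) z) = 1 := by
  let ld : {d // G.src d = u} → C.tree.Dart := fun d => C.liftDart x d.1 (d.2.trans hu.symm)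
  have hfst : ∀ d, (ld d).fst = x := fun d => C.liftDart_fst _ _ _
  have hpr : ∀ d, C.dartProj (ld d) = d.1 := fun d => C.dartProj_liftDart _ _ _
  have hb : ∀ d, IsBranch (C.jacobiMatrix J) (Subtype.val : C.plusSide (ld d) → X) x
      ⟨(ld d).snd, C.snd_mem_plusSide _⟩ (J.a d.1) := fun d => by
    have := C.isBranch_plusSide J (ld d)
    rwa [hfst, hpr] at this
  have h := resolventEntry_mul_schur (C.jacobiMatrix_schurBounded J) hb (C.jacobiMatrix_symm J)
    (by
      intro j hj h0
      have hadj : C.tree.Adj x j := by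
        by_contra hadj
        exact h0 (C.jacobiMatrix_eq_zero J hj.symm hadj)
      let e : C.tree.Dart := ⟨(x, j), hadj⟩
      refine ⟨⟨C.dartProj e, (C.src_dartProj e).trans hu⟩, ?_⟩
      have : ld ⟨C.dartProj e, (C.src_dartProj e).trans hu⟩ = e :=
        C.eq_of_fst_of_dartProj (hfst _) (hpr _)
      exact congrArg (fun e : C.tree.Dart => e.snd) this)
    (by
      intro d d' hdd
      have : ld d = ld d' :=
        SimpleGraph.Dart.ext _ _ (Prod.ext ((hfst d).trans (hfst d').symm) hdd)
      exact Subtype.ext ((hpr d).symm.trans ((congrArg C.dartProj this).trans (hpr d'))))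
    ((C.isSelfAdjoint_jacobiOp J).notMem_spectrum hz)
    (fun d => (C.isSelfAdjoint_plusOp J (ld d)).notMem_spectrum hz)
  rw [jacobiMatrix_self, hu] at h
  exact h

/-- Same as at a vertex of the full tree, but at the root of a branch the neighbor `e.fst` is
missing; it is reached by the lift of the reverse of c. -/
theorem mFun_mul_schur (e : C.tree.Dart) {c : D} (hc : C.dartProj e = c)
    [Fintype {d // G.src d = G.tgt c ∧ d ≠ G.inv c}] {z : ℂ} (hz : z.im ≠ 0) :
    C.mFun J e z * (J.b (G.tgt c) - z - ∑ d : {d // G.src d = G.tgt c ∧ d ≠ G.inv c},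
      (J.a d.1 : ℂ) ^ 2 * C.mFun J (C.liftDart e.snd d.1
        (d.2.1.trans ((congrArg G.tgt hc.symm).trans (C.proj_snd e).symm))) z) = 1 := by
  have hsrc : G.tgt c = C.proj e.snd := (congrArg G.tgt hc.symm).trans (C.proj_snd e).symm
  let ld : {d // G.src d = G.tgt c ∧ d ≠ G.inv c} → C.tree.Dart :=
    fun d => C.liftDart e.snd d.1 (d.2.1.trans hsrc)
  have hfst : ∀ d, (ld d).fst = e.snd := fun d => C.liftDart_fst _ _ _
  have hpr : ∀ d, C.dartProj (ld d) = d.1 := fun d => C.dartProj_liftDart _ _ _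
  have hne : ∀ d, ld d ≠ e.symm := fun d h => d.2.2 (by
    rw [← hpr d, h, C.dartProj_symm, hc])
  have hb := fun d => C.isBranch_inclusion J (hfst d) (hne d)
  have h := resolventEntry_mul_schur
    ((C.jacobiMatrix_schurBounded J).submatrix (Subtype.val_injective (p := (· ∈ C.plusSide e))))
    hb (fun _ _ => C.jacobiMatrix_symm J _ _)
    (by
      rintro ⟨j, hjm⟩ hj h0
      have hj' : e.snd ≠ j := fun h => hj (Subtype.ext h.symm)
      have hadj : C.tree.Adj e.snd j := by
        by_contra hadj
        exact h0 (C.jacobiMatrix_eq_zero J hj' hadj)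
      let e' : C.tree.Dart := ⟨(e.snd, j), hadj⟩
      have hne' : C.dartProj e' ≠ G.inv c := by
        intro h1
        rw [← hc, ← C.dartProj_symm] at h1
        have h2 := C.eq_of_fst_of_dartProj (e := e') (e' := e.symm) rfl h1
        have h3 : j = e.fst := congrArg (fun e : C.tree.Dart => e.snd) h2
        exact C.fst_notMem_plusSide e (h3 ▸ hjm)
      refine ⟨⟨C.dartProj e', (C.src_dartProj e').trans hsrc.symm, hne'⟩, ?_⟩
      have : ld ⟨C.dartProj e', (C.src_dartProj e').trans hsrc.symm, hne'⟩ = e' :=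
        C.eq_of_fst_of_dartProj (hfst _) (hpr _)
      exact Subtype.ext (congrArg (fun e : C.tree.Dart => e.snd) this))
    (by
      intro d d' hdd
      have : ld d = ld d' := SimpleGraph.Dart.ext _ _
        (Prod.ext ((hfst d).trans (hfst d').symm) (congrArg Subtype.val hdd))
      exact Subtype.ext ((hpr d).symm.trans ((congrArg C.dartProj this).trans (hpr d'))))
    ((C.isSelfAdjoint_plusOp J e).notMem_spectrum hz)
    (fun d => (C.isSelfAdjoint_plusOp J (ld d)).notMem_spectrum hz)
  simp only [jacobiMatrix_self, ← hsrc, hpr] at h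
  exact h

open Finset in
-- Two lifts of one edge satisfy the same recursion, with lifts of the same edges one level deeper.
-- The difference of the m-functions is m m' times the difference of these sums, and |m|, |m'| ≤
-- 1/|Im z|, so each level gains a factor (∑ a²)/|Im z|².
theorem norm_mFun_sub_le [Fintype D] {z : ℂ} (hz : z.im ≠ 0) (n : ℕ) :
    ∀ e e' : C.tree.Dart, C.dartProj e = C.dartProj e' →
      ‖C.mFun J e z - C.mFun J e' z‖ ≤
        2 * |z.im|⁻¹ * ((∑ d, J.a d ^ 2) * (|z.im|⁻¹) ^ 2) ^ n := by
  classical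
  have hbd : ∀ e, ‖C.mFun J e z‖ ≤ |z.im|⁻¹ :=
    fun e => norm_resolventEntry_le (C.isSelfAdjoint_plusOp J e) hz _
  induction n with
  | zero =>
    intro e e' _
    rw [pow_zero, mul_one]
    exact (norm_sub_le _ _).trans (by linarith [hbd e, hbd e'])
  | succ n ih =>
    intro e e' hee
    set B := 2 * |z.im|⁻¹ * ((∑ d, J.a d ^ 2) * (|z.im|⁻¹) ^ 2) ^ n with hB
    have hB0 : 0 ≤ B := by positivity
    have hsrc : ∀ e₁, C.dartProj e₁ = C.dartProj e' →
        ∀ d : {d // G.src d = G.tgt (C.dartProj e') ∧ d ≠ G.inv (C.dartProj e')},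
          G.src d.1 = C.proj e₁.snd :=
      fun e₁ h d => d.2.1.trans ((congrArg G.tgt h.symm).trans (C.proj_snd e₁).symm)
    let σ : ∀ e₁, C.dartProj e₁ = C.dartProj e' → ℂ := fun e₁ h =>
      ∑ d : {d // G.src d = G.tgt (C.dartProj e') ∧ d ≠ G.inv (C.dartProj e')},
        (J.a d.1 : ℂ) ^ 2 * C.mFun J (C.liftDart e₁.snd d.1 (hsrc e₁ h d)) z
    have h1 : C.mFun J e z * (J.b (G.tgt (C.dartProj e')) - z - σ e hee) = 1 :=
      C.mFun_mul_schur J e hee hz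
    have h2 : C.mFun J e' z * (J.b (G.tgt (C.dartProj e')) - z - σ e' rfl) = 1 :=
      C.mFun_mul_schur J e' rfl hz
    have h3 : C.mFun J e z - C.mFun J e' z = C.mFun J e z * C.mFun J e' z * (σ e hee - σ e' rfl) := by
      linear_combination C.mFun J e' z * h1 - C.mFun J e z * h2
    have h4 : ‖σ e hee - σ e' rfl‖ ≤ (∑ d, J.a d ^ 2) * B := by
      rw [← sum_sub_distrib, sum_mul]
      refine (norm_sum_le _ _).trans ?_
      refine le_trans (sum_le_sum (g := fun d => J.a d.1 ^ 2 * B) fun d _ => ?_) ?_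
      · rw [← mul_sub, norm_mul, norm_pow, Complex.norm_real, Real.norm_eq_abs, sq_abs]
        refine mul_le_mul_of_nonneg_left (ih _ _ ?_) (sq_nonneg _)
        rw [C.dartProj_liftDart, C.dartProj_liftDart]
      · rw [← sum_subtype (univ.filter fun d => G.src d = G.tgt (C.dartProj e') ∧
          d ≠ G.inv (C.dartProj e')) (by simp) (fun d => J.a d ^ 2 * B)]
        exact sum_le_univ_sum_of_nonneg fun d => by positivity
    rw [h3, norm_mul, norm_mul]
    calc _ ≤ |z.im|⁻¹ * |z.im|⁻¹ * ((∑ d, J.a d ^ 2) * B) := by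
          gcongr
          · exact hbd e
          · exact hbd e'
      _ = _ := by rw [hB]; ring

theorem isPreconnected_upperHalf : IsPreconnected {z : ℂ | 0 < z.im} :=
  (convex_halfSpace_im_gt 0).isPreconnected

/-- In the upper half plane, the `m`-function of a directed edge depends only on its projection. -/
theorem mFun_eq_of_dartProj_eq {e e' : C.tree.Dart} (h : C.dartProj e = C.dartProj e') {z : ℂ}
    (hz : 0 < z.im) : C.mFun J e z = C.mFun J e' z := by
  cases nonempty_fintype D
  set S := ∑ d, J.a d ^ 2 with hS
  have hS0 : 0 ≤ S := by positivity
  -- For Im z > S + 1 the contraction factor S/(Im z)² is below 1; the identity theorem then covers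
  -- the rest of the half plane.
  have hlarge : ∀ z : ℂ, S + 1 < z.im → C.mFun J e z = C.mFun J e' z := by
    intro z hz
    have hz0 : 0 < z.im := by linarith
    rw [← sub_eq_zero, ← norm_le_zero_iff]
    have hθ : S * (|z.im|⁻¹) ^ 2 < 1 := by
      rw [abs_of_pos hz0, inv_pow, ← div_eq_mul_inv, div_lt_one (by positivity)]
      nlinarith
    have ht : Filter.Tendsto (fun n : ℕ => 2 * |z.im|⁻¹ * (S * (|z.im|⁻¹) ^ 2) ^ n) Filter.atTop
        (𝓝 (2 * |z.im|⁻¹ * 0)) :=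
      (tendsto_pow_atTop_nhds_zero_of_lt_one (by positivity) hθ).const_mul _
    rw [mul_zero] at ht
    exact ge_of_tendsto' ht fun n => C.norm_mFun_sub_le J hz0.ne' n e e' h
  have hz1 : (0 : ℝ) < (((S + 2 : ℝ) : ℂ) * Complex.I).im := by simp; linarith
  refine (analyticOnNhd_resolventEntry (C.isSelfAdjoint_plusOp J e)
    _).eqOn_of_preconnected_of_eventuallyEq (analyticOnNhd_resolventEntry
      (C.isSelfAdjoint_plusOp J e') _) isPreconnected_upperHalf hz1 ?_ hz
  have ho : IsOpen {z : ℂ | S + 1 < z.im} := isOpen_lt continuous_const Complex.continuous_im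
  filter_upwards [ho.mem_nhds (show S + 1 < (((S + 2 : ℝ) : ℂ) * Complex.I).im by simp)]
    with w hw
  exact hlarge w hw

end Jacobi

end UniversalCover

/-! ### Spectral measures and the resolvent. -/

section SpectralMeasureLemmas

open MeasureTheory
open scoped CompactlySupported

variable {E : Type*} [NormedAddCommGroup E] [InnerProductSpace ℂ E] [CompleteSpace E]

instance regular_spectralMeasure (T : E →L[ℂ] E) (ψ : E) : (spectralMeasure T ψ).Regular :=
  RealRMK.regular_rieszMeasure _

theorem integral_spectralMeasure_cc (T : E →L[ℂ] E) (ψ : E) (f : C_c(ℝ, ℝ)) :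
    ∫ t, f t ∂(spectralMeasure T ψ) = (inner ℂ ψ (cfc (f : ℝ → ℝ) T ψ)).re :=
  RealRMK.integral_rieszMeasure _ f

theorem abs_le_norm_of_mem_spectrum {T : E →L[ℂ] E} {t : ℝ} (ht : t ∈ spectrum ℝ T) :
    |t| ≤ ‖T‖ :=
  (spectrum.norm_le_norm_mul_of_mem ht).trans
    ((mul_le_mul_of_nonneg_left ContinuousLinearMap.norm_id_le (norm_nonneg _)).trans_eq
      (mul_one _))

/-- A nonnegative tent function, positive exactly for ‖T‖ < |t| < n, vanishes on the spectrum and so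
has integral zero. The cutoff n makes its support compact, and varying n exhausts |t| > ‖T‖. -/
theorem ae_abs_le_norm_spectralMeasure (T : E →L[ℂ] E) (ψ : E) :
    ∀ᵐ t ∂(spectralMeasure T ψ), |t| ≤ ‖T‖ := by
  have key : ∀ n : ℕ, ∀ᵐ t ∂(spectralMeasure T ψ), max 0 (min (|t| - ‖T‖) (n - |t|)) = 0 := by
    intro n
    let f : C_c(ℝ, ℝ) :=
      ⟨⟨fun t => max 0 (min (|t| - ‖T‖) (n - |t|)), by fun_prop⟩, by
        refine HasCompactSupport.intro (isCompact_Icc (a := -(n : ℝ)) (b := n)) fun t ht => ?_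
        rw [Set.mem_Icc, ← abs_le, not_le] at ht
        exact max_eq_left ((min_le_right _ _).trans (by linarith))⟩
    have h1 := integral_spectralMeasure_cc T ψ f
    have h2 : cfc (f : ℝ → ℝ) T = cfc (fun _ : ℝ => (0 : ℝ)) T :=
      cfc_congr fun t ht => max_eq_left ((min_le_left _ _).trans
        (by linarith [abs_le_norm_of_mem_spectrum ht]))
    rw [h2, cfc_const_zero, zero_apply, inner_zero_right, Complex.zero_re,
      integral_eq_zero_iff_of_nonneg (f := f) (fun t => le_max_left _ _)
        (f.continuous.integrable_of_hasCompactSupport f.hasCompactSupport)] at h1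
    exact h1
  filter_upwards [ae_all_iff.2 key] with t ht
  by_contra h
  push Not at h
  obtain ⟨n, hn⟩ := exists_nat_gt |t|
  have := ht n
  rw [max_eq_left_iff, min_le_iff] at this
  rcases this with h | h <;> linarith

/-- The measure is defined through compactly supported functions. Multiplying g by a plateau equal
to 1 on [-‖T‖, ‖T‖] changes neither the integral nor the functional calculus. -/
theorem integrable_and_integral_spectralMeasure (T : E →L[ℂ] E) (ψ : E)
    {g : ℝ → ℝ} (hg : Continuous g) : Integrable g (spectralMeasure T ψ) ∧
      ∫ t, g t ∂(spectralMeasure T ψ) = (inner ℂ ψ (cfc g T ψ)).re := by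
  let f : C_c(ℝ, ℝ) :=
    ⟨⟨fun t => g t * max 0 (min 1 (‖T‖ + 1 - |t|)), by fun_prop⟩, by
      refine HasCompactSupport.intro
        (isCompact_Icc (a := -(‖T‖ + 1)) (b := ‖T‖ + 1)) fun t ht => ?_
      rw [Set.mem_Icc, ← abs_le, not_le] at ht
      change g t * max 0 (min 1 (‖T‖ + 1 - |t|)) = 0
      rw [max_eq_left ((min_le_right _ _).trans (by linarith)), mul_zero]⟩
  have hfg : ∀ t, |t| ≤ ‖T‖ → f t = g t := fun t ht => by
    change g t * max 0 (min 1 (‖T‖ + 1 - |t|)) = g t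
    rw [min_eq_left (by linarith), max_eq_right zero_le_one, mul_one]
  have hae : f =ᵐ[spectralMeasure T ψ] g := by
    filter_upwards [ae_abs_le_norm_spectralMeasure T ψ] with t ht using hfg t ht
  refine ⟨(f.continuous.integrable_of_hasCompactSupport f.hasCompactSupport).congr hae, ?_⟩
  rw [← integral_congr_ae hae, integral_spectralMeasure_cc,
    cfc_congr fun t ht => hfg t (abs_le_norm_of_mem_spectrum ht)]

instance isFiniteMeasure_spectralMeasure (T : E →L[ℂ] E) (ψ : E) :
    IsFiniteMeasure (spectralMeasure T ψ) := by
  have h := (integrable_and_integral_spectralMeasure T ψ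
    (continuous_const : Continuous fun _ => (1 : ℝ))).1
  exact (integrable_const_iff.1 h).resolve_left one_ne_zero

theorem isProbabilityMeasure_spectralMeasure {T : E →L[ℂ] E} (hT : IsSelfAdjoint T) {ψ : E}
    (hψ : ‖ψ‖ = 1) : IsProbabilityMeasure (spectralMeasure T ψ) := by
  have h := (integrable_and_integral_spectralMeasure T ψ
    (continuous_const : Continuous fun _ => (1 : ℝ))).2
  rw [integral_const, cfc_const_one ℝ T, one_apply_eq_self, inner_self_eq_norm_sq_to_K, hψ] at h
  rw [isProbabilityMeasure_iff, ← ENNReal.toReal_eq_one_iff]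
  simpa [Measure.real] using h

/-- The spectral measure knows only real functions, so (t - z)⁻¹ is split into its real and
imaginary parts f₁ and f₂, and f₁(T) + i f₂(T) is checked to be the inverse of T - z. -/
theorem integral_inv_sub_spectralMeasure {T : E →L[ℂ] E} (hT : IsSelfAdjoint T) (ψ : E) {z : ℂ}
    (hz : z.im ≠ 0) : ∫ t : ℝ, ((t : ℂ) - z)⁻¹ ∂(spectralMeasure T ψ) =
      inner ℂ ψ (Ring.inverse (T - z • (1 : E →L[ℂ] E)) ψ) := by
  set q : ℝ → ℝ := fun t => (t - z.re) ^ 2 + z.im ^ 2 with hq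
  have hq0 : ∀ t, q t ≠ 0 := fun t => by positivity
  set f₁ : ℝ → ℝ := fun t => (t - z.re) / q t with hf₁
  set f₂ : ℝ → ℝ := fun t => z.im / q t with hf₂
  have hc₁ : Continuous f₁ := Continuous.div (by fun_prop) (by fun_prop) hq0
  have hc₂ : Continuous f₂ := Continuous.div (by fun_prop) (by fun_prop) hq0
  have hsplit : ∀ t : ℝ, ((t : ℂ) - z)⁻¹ = f₁ t + Complex.I * f₂ t := by
    intro t
    have hq' : (q t : ℂ) ≠ 0 := by exact_mod_cast hq0 t
    have hz' : (t : ℂ) - z = ((t - z.re : ℝ) : ℂ) - z.im * Complex.I := by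
      conv_lhs => rw [← Complex.re_add_im z]
      push_cast
      ring
    have hq2 : (q t : ℂ) = ((t - z.re : ℝ) : ℂ) ^ 2 + (z.im : ℂ) ^ 2 := by
      simp only [hq]; push_cast; ring
    apply inv_eq_of_mul_eq_one_right
    rw [hz']
    simp only [hf₁, hf₂, Complex.ofReal_div]
    field_simp
    rw [hq2]
    linear_combination -(z.im : ℂ) ^ 2 * Complex.I_sq
  set A := cfc f₁ T with hA
  set B := cfc f₂ T with hB
  have hX : cfc (fun t : ℝ => t - z.re) T = T - z.re • (1 : E →L[ℂ] E) := by
    rw [cfc_sub (fun t : ℝ => t) (fun _ => z.re) T, cfc_id' ℝ T, cfc_const z.re T,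
      Algebra.algebraMap_eq_smul_one]
  have e₁ : (T - z.re • (1 : E →L[ℂ] E)) * A + z.im • B = 1 := by
    rw [← hX, hA, hB, ← cfc_mul (fun t : ℝ => t - z.re) f₁ T (by fun_prop) hc₁.continuousOn,
      ← cfc_smul z.im f₂ T hc₂.continuousOn, ← cfc_add T _ _
        (by fun_prop) (by fun_prop), ← cfc_const_one ℝ T]
    refine cfc_congr fun t _ => ?_
    have := hq0 t
    simp only [hf₁, hf₂, smul_eq_mul]
    field_simp
    simp only [hq]
  have e₂ : (T - z.re • (1 : E →L[ℂ] E)) * B - z.im • A = 0 := by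
    rw [← hX, hA, hB, ← cfc_mul (fun t : ℝ => t - z.re) f₂ T (by fun_prop) hc₂.continuousOn,
      ← cfc_smul z.im f₁ T hc₁.continuousOn, ← cfc_sub _ _ T
        (by fun_prop) (by fun_prop), ← cfc_const_zero ℝ T]
    refine cfc_congr fun t _ => ?_
    simp only [hf₁, hf₂, smul_eq_mul]
    ring
  have hzz : T - z • (1 : E →L[ℂ] E) =
      (T - z.re • (1 : E →L[ℂ] E)) - (Complex.I * z.im) • (1 : E →L[ℂ] E) := by
    conv_lhs => rw [← Complex.re_add_im z]
    rw [add_smul, ← Complex.coe_smul, mul_comm Complex.I]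
    abel
  have hmul : (T - z • (1 : E →L[ℂ] E)) * (A + Complex.I • B) = 1 := by
    have e₁' : (T - z.re • (1 : E →L[ℂ] E)) * A = 1 - (z.im : ℂ) • B := by
      rw [Complex.coe_smul]
      exact eq_sub_of_add_eq e₁
    have e₂' : (T - z.re • (1 : E →L[ℂ] E)) * B = (z.im : ℂ) • A := by
      rw [sub_eq_zero] at e₂
      rw [e₂, Complex.coe_smul]
    rw [hzz, sub_mul, mul_add, e₁', mul_smul_comm, e₂', smul_mul_assoc, one_mul, smul_add,
      smul_smul, smul_smul, show Complex.I * z.im * Complex.I = -z.im by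
        linear_combination (z.im : ℂ) * Complex.I_sq]
    module
  have hunit : IsUnit (T - z • (1 : E →L[ℂ] E)) := by
    have : z ∉ spectrum ℂ T := fun h => hz (by
      rw [hT.mem_spectrum_eq_re h]; exact Complex.ofReal_im _)
    rw [spectrum.notMem_iff, ← IsUnit.neg_iff, neg_sub, Algebra.algebraMap_eq_smul_one] at this
    exact this
  have hinv : Ring.inverse (T - z • (1 : E →L[ℂ] E)) = A + Complex.I • B := by
    have h := congrArg (Ring.inverse (T - z • (1 : E →L[ℂ] E)) * ·) hmul
    simp only [mul_one, ← mul_assoc, Ring.inverse_mul_cancel _ hunit, one_mul] at h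
    exact h.symm
  have hreal : ∀ f : ℝ → ℝ, ((inner ℂ ψ (cfc f T ψ)).re : ℂ) = inner ℂ ψ (cfc f T ψ) := by
    intro f
    have h1 : IsSelfAdjoint (cfc f T) := cfc_predicate f T
    refine Complex.conj_eq_iff_re.1 ?_
    rw [inner_conj_symm, ← ContinuousLinearMap.adjoint_inner_right, h1.adjoint_eq]
  obtain ⟨i₁, h₁⟩ := integrable_and_integral_spectralMeasure T ψ hc₁
  obtain ⟨i₂, h₂⟩ := integrable_and_integral_spectralMeasure T ψ hc₂
  simp only [hsplit]
  rw [integral_add i₁.ofReal (i₂.ofReal.const_mul _), integral_const_mul, integral_complex_ofReal,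
    integral_complex_ofReal, h₁, h₂, hreal, hreal, hinv, add_apply, smul_apply, inner_add_right,
    inner_smul_right]

end SpectralMeasureLemmas

/-! ### The logarithmic potential. -/

section LogPotential

open MeasureTheory

variable {μ : Measure ℝ} {R : ℝ}

theorem ofReal_sub_mem_slitPlane {z : ℂ} (hz : 0 < z.im) (t : ℝ) :
    (t : ℂ) - z ∈ Complex.slitPlane := by
  right
  simp [hz.ne']

theorem integrable_of_continuous_of_ae_abs_le [IsFiniteMeasure μ] (hμ : ∀ᵐ t ∂μ, |t| ≤ R)
    {g : ℝ → ℂ} (hg : Continuous g) : Integrable g μ := by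
  obtain ⟨K, hK⟩ := (isCompact_Icc (a := -R) (b := R)).exists_bound_of_continuousOn hg.continuousOn
  refine Integrable.of_bound hg.aestronglyMeasurable K ?_
  filter_upwards [hμ] with t ht using hK t (abs_le.1 ht)

theorem continuous_log_sub {z : ℂ} (hz : 0 < z.im) :
    Continuous fun t : ℝ => Complex.log ((t : ℂ) - z) :=
  Continuous.clog (by fun_prop) (ofReal_sub_mem_slitPlane hz)

theorem hasDerivAt_integral_log_sub [IsFiniteMeasure μ] (hμ : ∀ᵐ t ∂μ, |t| ≤ R) {z : ℂ}
    (hz : 0 < z.im) : HasDerivAt (fun w : ℂ => ∫ t : ℝ, Complex.log ((t : ℂ) - w) ∂μ)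
      (-∫ t : ℝ, ((t : ℂ) - z)⁻¹ ∂μ) z := by
  -- On this neighborhood |t - w| exceeds Im z / 2, which gives a constant dominating function for
  -- the derivative.
  have hs : {w : ℂ | z.im / 2 < w.im} ∈ 𝓝 z :=
    (isOpen_lt continuous_const Complex.continuous_im).mem_nhds (half_lt_self hz)
  have hs0 : ∀ w ∈ {w : ℂ | z.im / 2 < w.im}, 0 < w.im := fun w hw => (half_pos hz).trans hw
  have h := hasDerivAt_integral_of_dominated_loc_of_deriv_le (μ := μ) (𝕜 := ℂ) hs
    (F := fun (w : ℂ) (t : ℝ) => Complex.log ((t : ℂ) - w))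
    (F' := fun (w : ℂ) (t : ℝ) => -((t : ℂ) - w)⁻¹) (bound := fun _ => (z.im / 2)⁻¹)
    (by
      filter_upwards [hs] with w hw
      exact (continuous_log_sub (hs0 w hw)).aestronglyMeasurable)
    (integrable_of_continuous_of_ae_abs_le hμ (continuous_log_sub hz))
    (by
      refine Continuous.aestronglyMeasurable (Continuous.neg (Continuous.inv₀ (by fun_prop) ?_))
      exact fun t => Complex.slitPlane_ne_zero (ofReal_sub_mem_slitPlane hz t))
    (Filter.Eventually.of_forall fun t w hw => by
      rw [norm_neg, norm_inv]
      refine inv_anti₀ (half_pos hz) ?_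
      have := Complex.abs_im_le_norm ((t : ℂ) - w)
      simp only [Complex.sub_im, Complex.ofReal_im, zero_sub, abs_neg] at this
      exact (le_of_lt hw).trans ((le_abs_self _).trans this))
    (integrable_const _)
    (Filter.Eventually.of_forall fun t w hw => by
      have h1 : HasDerivAt (fun w : ℂ => (t : ℂ) - w) (-1) w := by
        simpa using (hasDerivAt_id w).const_sub (t : ℂ)
      have h2 := h1.clog (ofReal_sub_mem_slitPlane (hs0 w hw) t)
      rwa [neg_div, one_div] at h2)
  rw [← integral_neg]
  exact h.2

/-- Factor t - iy = -iy (1 + it/y). The principal logarithm is additive here, since arg(-iy) = -π/2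
and |arg(1 + it/y)| < π/2. The assumption 2R ≤ y puts it/y in the disc where |log(1 + w)| ≤
(3/2)|w|. -/
theorem norm_integral_log_sub_le [IsProbabilityMeasure μ] (hμ : ∀ᵐ t ∂μ, |t| ≤ R) {y : ℝ}
    (hy : 0 < y) (hRy : 2 * R ≤ y) :
    ‖∫ t : ℝ, Complex.log ((t : ℂ) - y * Complex.I) ∂μ - Complex.log (-(y * Complex.I))‖ ≤
      3 / 2 * (R / y) := by
  have hyI : 0 < ((y : ℂ) * Complex.I).im := by simpa using hy
  have hi := integrable_of_continuous_of_ae_abs_le hμ (continuous_log_sub hyI)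
  have h1 : ∫ t : ℝ, Complex.log ((t : ℂ) - y * Complex.I) ∂μ - Complex.log (-(y * Complex.I)) =
      ∫ t : ℝ, (Complex.log ((t : ℂ) - y * Complex.I) - Complex.log (-(y * Complex.I))) ∂μ := by
    rw [integral_sub hi (integrable_const _)]
    simp
  rw [h1]
  refine (norm_integral_le_of_norm_le_const (C := 3 / 2 * (R / y)) ?_).trans_eq (by simp)
  filter_upwards [hμ] with t ht
  have hy' : (y : ℂ) ≠ 0 := by exact_mod_cast hy.ne'
  set w : ℂ := ((t / y : ℝ) : ℂ) * Complex.I with hw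
  have hwn : ‖w‖ = |t| / y := by
    rw [hw, norm_mul, Complex.norm_real, Complex.norm_I, mul_one, Real.norm_eq_abs, abs_div,
      abs_of_pos hy]
  have hwR : ‖w‖ ≤ R / y := by rw [hwn]; gcongr
  have hw2 : ‖w‖ ≤ 1 / 2 := hwR.trans (by rw [div_le_iff₀ hy]; linarith)
  have h2 : (t : ℂ) - y * Complex.I = -(y * Complex.I) * (1 + w) := by
    rw [hw]
    push_cast
    field_simp
    linear_combination (t : ℂ) * Complex.I_sq
  have hre : 0 < (1 + w).re := by simp [hw]
  have harg1 : Complex.arg (-(y * Complex.I)) = -(Real.pi / 2) := by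
    rw [← mul_neg, Complex.arg_real_mul _ hy, Complex.arg_neg_I]
  have harg2 := abs_lt.1 (Complex.abs_arg_lt_pi_div_two_iff.2 (Or.inl hre))
  have h3 : Complex.log ((t : ℂ) - y * Complex.I) - Complex.log (-(y * Complex.I)) =
      Complex.log (1 + w) := by
    rw [h2, Complex.log_mul (by simp [hy']) (fun h => by rw [h] at hre; simp at hre)
      ⟨by rw [harg1]; linarith [harg2.1], by rw [harg1]; linarith [harg2.2, Real.pi_pos]⟩]
    ring
  rw [h3]
  exact (Complex.norm_log_one_add_half_le_self hw2).trans (by gcongr)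

end LogPotential

/-! ### Logarithmic derivatives of Green's functions and edge denominators. -/

theorem MGraph.IsOrientation.sum_univ {V D M : Type*} [Fintype D] [AddCommMonoid M]
    {G : MGraph V D} {E : Finset D} (hE : G.IsOrientation E) (f : D → M) :
    ∑ d, f d = ∑ e ∈ E, (f e + f (G.inv e)) := by
  classical
  rw [← Finset.sum_filter_add_sum_filter_not Finset.univ (· ∈ E), Finset.sum_add_distrib]
  congr 1
  · congr 1
    ext d
    simp
  · refine Finset.sum_nbij' G.inv G.inv ?_ ?_ ?_ ?_ ?_
    · intro d hd
      by_contra h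
      exact (Finset.mem_filter.1 hd).2 ((hE d).2 h)
    · intro d hd
      simpa using (hE d).1 hd
    · exact fun d _ => G.inv_inv d
    · exact fun d _ => G.inv_inv d
    · exact fun d _ => by rw [G.inv_inv]

theorem MGraph.tgt_inv {V D : Type*} (G : MGraph V D) (d : D) : G.tgt (G.inv d) = G.src d := by
  rw [tgt, G.inv_inv]

theorem DifferentiableAt.hasDerivAt_mul_eq_zero {f g : ℂ → ℂ} {c z : ℂ}
    (hf : DifferentiableAt ℂ f z) (hg : DifferentiableAt ℂ g z)
    (h : ∀ᶠ w in 𝓝 z, f w * g w = c) : deriv f z * g z + f z * deriv g z = 0 := by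
  have h1 := (hf.hasDerivAt.fun_mul hg.hasDerivAt).deriv
  rw [← h1, Filter.EventuallyEq.deriv_eq (f := fun _ => c) h]
  simp

theorem eventually_im_pos {z : ℂ} (hz : 0 < z.im) : ∀ᶠ w in 𝓝 z, 0 < w.im :=
  (isOpen_lt continuous_const Complex.continuous_im).mem_nhds hz

namespace UniversalCover

section Lifts

variable {V D X : Type*} [Finite V] [Finite D] {G : MGraph V D} (C : UniversalCover G X)
  (J : JacobiParameters G)

theorem differentiableAt_green (x : X) {z : ℂ} (hz : z.im ≠ 0) :
    DifferentiableAt ℂ (C.green J x) z :=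
  differentiableAt_resolventEntry ((C.isSelfAdjoint_jacobiOp J).notMem_spectrum hz) _

theorem differentiableAt_mFun (e : C.tree.Dart) {z : ℂ} (hz : z.im ≠ 0) :
    DifferentiableAt ℂ (C.mFun J e) z :=
  differentiableAt_resolventEntry ((C.isSelfAdjoint_plusOp J e).notMem_spectrum hz) _

theorem green_ne_zero (x : X) {z : ℂ} (hz : z.im ≠ 0) : C.green J x z ≠ 0 :=
  resolventEntry_ne_zero (C.isSelfAdjoint_jacobiOp J) hz _

/-- The denominator `1 - a_e² m_e m_ě` of `Q_e`. -/
def edgeDenom (dl : D → C.tree.Dart) (d : D) (z : ℂ) : ℂ :=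
  1 - (J.a d : ℂ) ^ 2 * C.mFun J (dl d) z * C.mFun J (dl (G.inv d)) z

theorem differentiableAt_edgeDenom (dl : D → C.tree.Dart) (d : D) {z : ℂ} (hz : z.im ≠ 0) :
    DifferentiableAt ℂ (C.edgeDenom J dl d) z :=
  (((C.differentiableAt_mFun J _ hz).const_mul _).mul (C.differentiableAt_mFun J _ hz)).const_sub _

/-- If a² m m' = 1, then m times a nonnegative number is the conjugate of m'. That is impossible, as
the imaginary parts of m and m' both have the sign of Im z. -/
theorem edgeDenom_ne_zero (dl : D → C.tree.Dart) (d : D) {z : ℂ} (hz : z.im ≠ 0) :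
    C.edgeDenom J dl d z ≠ 0 := by
  intro h
  have h1 := resolventEntry_im_mul_pos (C.isSelfAdjoint_plusOp J (dl d)) hz
    ⟨_, C.snd_mem_plusSide _⟩
  have h2 := resolventEntry_im_mul_pos (C.isSelfAdjoint_plusOp J (dl (G.inv d))) hz
    ⟨_, C.snd_mem_plusSide _⟩
  change 0 < (C.mFun J (dl d) z).im * _ at h1
  change 0 < (C.mFun J (dl (G.inv d)) z).im * _ at h2
  rw [edgeDenom] at h
  set m := C.mFun J (dl d) z
  set m' := C.mFun J (dl (G.inv d)) z
  have h3 : ((J.a d ^ 2 * Complex.normSq m' : ℝ) : ℂ) * m = (starRingEnd ℂ) m' := by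
    push_cast
    rw [Complex.normSq_eq_conj_mul_self]
    linear_combination -(starRingEnd ℂ) m' * h
  have h4 := congrArg Complex.im h3
  rw [Complex.im_ofReal_mul, Complex.conj_im] at h4
  have h5 : 0 ≤ J.a d ^ 2 * Complex.normSq m' := mul_nonneg (sq_nonneg _) (Complex.normSq_nonneg _)
  have h6 : (J.a d ^ 2 * Complex.normSq m') * (m.im * z.im) = -(m'.im * z.im) := by
    linear_combination z.im * h4
  linarith [mul_nonneg h5 h1.le]

theorem edgeDenom_inv (dl : D → C.tree.Dart) (d : D) (z : ℂ) :
    C.edgeDenom J dl (G.inv d) z = C.edgeDenom J dl d z := by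
  rw [edgeDenom, edgeDenom, J.a_inv, G.inv_inv]
  ring

end Lifts

section Recursion

variable {V D X : Type*} [Fintype V] [Fintype D] [DecidableEq V]
  {G : MGraph V D} (C : UniversalCover G X) (J : JacobiParameters G)
  {vl : V → X} {dl : D → C.tree.Dart}

theorem green_mul_eq_one (hvl : ∀ u, C.proj (vl u) = u) (hdl : ∀ d, C.dartProj (dl d) = d)
    (u : V) {z : ℂ} (hz : 0 < z.im) :
    C.green J (vl u) z * (J.b u - z - ∑ d with G.src d = u,
      (J.a d : ℂ) ^ 2 * C.mFun J (dl d) z) = 1 := by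
  rw [← C.green_mul_schur J (vl u) (hvl u) hz.ne',
    Finset.sum_subtype (p := fun d => G.src d = u) _ (by simp)]
  congr 2
  refine Finset.sum_congr rfl fun d _ => ?_
  rw [C.mFun_eq_of_dartProj_eq J ((hdl _).trans (C.dartProj_liftDart _ _ _).symm) hz]

/-- Differentiate the Schur identity. The last factor is written at `G.src d` rather than u, so that
the sums over all u merge into one sum over directed edges. -/
theorem logDeriv_green (hvl : ∀ u, C.proj (vl u) = u) (hdl : ∀ d, C.dartProj (dl d) = d)
    (u : V) {z : ℂ} (hz : 0 < z.im) :
    logDeriv (C.green J (vl u)) z = C.green J (vl u) z + ∑ d with G.src d = u,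
      (J.a d : ℂ) ^ 2 * deriv (C.mFun J (dl d)) z * C.green J (vl (G.src d)) z := by
  have hG := C.differentiableAt_green J (vl u) hz.ne'
  have hm := fun d => C.differentiableAt_mFun J (dl d) hz.ne'
  have hg : HasDerivAt (fun w => J.b u - w - ∑ d with G.src d = u,
      (J.a d : ℂ) ^ 2 * C.mFun J (dl d) w) (-1 - ∑ d with G.src d = u,
      (J.a d : ℂ) ^ 2 * deriv (C.mFun J (dl d)) z) z :=
    ((hasDerivAt_id z).const_sub _).sub
      (HasDerivAt.fun_sum fun d _ => (hm d).hasDerivAt.const_mul _)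
  have h1 := hG.hasDerivAt_mul_eq_zero hg.differentiableAt (c := 1)
    (by filter_upwards [eventually_im_pos hz] with w hw using C.green_mul_eq_one J hvl hdl u hw)
  rw [hg.deriv] at h1
  have h2 := C.green_mul_eq_one J hvl hdl u hz
  rw [logDeriv_apply, div_eq_iff (C.green_ne_zero J _ hz.ne')]
  have h3 : ∑ d with G.src d = u,
      (J.a d : ℂ) ^ 2 * deriv (C.mFun J (dl d)) z * C.green J (vl (G.src d)) z =
      (∑ d with G.src d = u, (J.a d : ℂ) ^ 2 * deriv (C.mFun J (dl d)) z) *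
        C.green J (vl u) z := by
    rw [Finset.sum_mul]
    refine Finset.sum_congr rfl fun d hd => ?_
    rw [(Finset.mem_filter.1 hd).2]
  rw [h3]
  linear_combination C.green J (vl u) z * h1 - deriv (C.green J (vl u)) z * h2

variable [DecidableEq D]

theorem mFun_mul_eq_one (hdl : ∀ d, C.dartProj (dl d) = d) (c : D) {z : ℂ} (hz : 0 < z.im) :
    C.mFun J (dl c) z * (J.b (G.tgt c) - z - ∑ d with G.src d = G.tgt c ∧ d ≠ G.inv c,
      (J.a d : ℂ) ^ 2 * C.mFun J (dl d) z) = 1 := by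
  rw [← C.mFun_mul_schur J (dl c) (hdl c) hz.ne',
    Finset.sum_subtype (p := fun d => G.src d = G.tgt c ∧ d ≠ G.inv c) _ (by simp)]
  congr 2
  refine Finset.sum_congr rfl fun d _ => ?_
  rw [C.mFun_eq_of_dartProj_eq J ((hdl _).trans (C.dartProj_liftDart _ _ _).symm) hz]

/-- The Schur identities for G at the initial vertex of d and for m of the reversed edge differ only
in the term of d: 1/G = 1/m_ď - a² m_d. -/
theorem mFun_inv_eq (hvl : ∀ u, C.proj (vl u) = u) (hdl : ∀ d, C.dartProj (dl d) = d)
    (d : D) {z : ℂ} (hz : 0 < z.im) :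
    C.mFun J (dl (G.inv d)) z = C.green J (vl (G.src d)) z * C.edgeDenom J dl d z := by
  have h1 := C.green_mul_eq_one J hvl hdl (G.src d) hz
  have h2 := C.mFun_mul_eq_one J hdl (G.inv d) hz
  rw [G.tgt_inv, G.inv_inv, Finset.filter_and_not, Finset.filter_eq' _ d] at h2
  simp only [Finset.mem_univ, if_true] at h2
  rw [← Finset.sum_sdiff (s₁ := {d}) (by simp), Finset.sum_singleton] at h1
  rw [edgeDenom]
  linear_combination C.green J (vl (G.src d)) z * h2 - C.mFun J (dl (G.inv d)) z * h1

/-- In the derivative of 1 - a² m_d m_ď each undifferentiated m is replaced by a Green's function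
times the denominator, by `mFun_inv_eq` for both directions, and the denominator cancels. -/
theorem logDeriv_edgeDenom (hvl : ∀ u, C.proj (vl u) = u) (hdl : ∀ d, C.dartProj (dl d) = d)
    (d : D) {z : ℂ} (hz : 0 < z.im) :
    logDeriv (C.edgeDenom J dl d) z =
      -((J.a d : ℂ) ^ 2 * deriv (C.mFun J (dl d)) z * C.green J (vl (G.src d)) z +
        (J.a (G.inv d) : ℂ) ^ 2 * deriv (C.mFun J (dl (G.inv d))) z *
          C.green J (vl (G.src (G.inv d))) z) := by
  have hm := fun d => (C.differentiableAt_mFun J (dl d) hz.ne').hasDerivAt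
  have hq : HasDerivAt (C.edgeDenom J dl d) _ z :=
    (((hm d).const_mul ((J.a d : ℂ) ^ 2)).mul (hm (G.inv d))).const_sub 1
  have h1 := C.mFun_inv_eq J hvl hdl d hz
  have h2 := C.mFun_inv_eq J hvl hdl (G.inv d) hz
  rw [G.inv_inv, C.edgeDenom_inv] at h2
  rw [logDeriv_apply, div_eq_iff (C.edgeDenom_ne_zero J dl d hz.ne'), hq.deriv, J.a_inv]
  linear_combination -(J.a d : ℂ) ^ 2 * deriv (C.mFun J (dl d)) z * h1 -
    (J.a d : ℂ) ^ 2 * deriv (C.mFun J (dl (G.inv d))) z * h2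

end Recursion

end UniversalCover

/-! ### The Floquet formula on the upper half plane. -/

section FloquetFormula

open MeasureTheory

variable {V D X : Type*} [Fintype V] [Finite D] {G : MGraph V D} (C : UniversalCover G X)
  (J : JacobiParameters G) (vl : V → X)

theorem isProbabilityMeasure_jacobiOp (x : X) :
    IsProbabilityMeasure (spectralMeasure (C.jacobiOp J) (delta x)) :=
  isProbabilityMeasure_spectralMeasure (C.isSelfAdjoint_jacobiOp J) (norm_delta x)

theorem integrable_log_sub_spectralMeasure (x : X) {z : ℂ} (hz : 0 < z.im) :
    Integrable (fun t : ℝ => Complex.log ((t : ℂ) - z))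
      (spectralMeasure (C.jacobiOp J) (delta x)) :=
  integrable_of_continuous_of_ae_abs_le (ae_abs_le_norm_spectralMeasure _ _) (continuous_log_sub hz)

theorem integrable_log_sub_densityOfStates (hV : Nonempty V) {z : ℂ} (hz : 0 < z.im) :
    Integrable (fun t : ℝ => Complex.log ((t : ℂ) - z)) (densityOfStates C J vl) := by
  refine Integrable.smul_measure (integrable_finsetSum_measure.2 fun u _ =>
    integrable_log_sub_spectralMeasure C J (vl u) hz) ?_
  simp

theorem floquet_eq (hV : Nonempty V) {z : ℂ} (hz : 0 < z.im) :
    floquet C J vl z = Complex.exp (∑ u, ∫ t : ℝ, Complex.log ((t : ℂ) - z)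
      ∂(spectralMeasure (C.jacobiOp J) (delta (vl u)))) := by
  rw [floquet, densityOfStates, integral_smul_measure, integral_finsetSum_measure fun u _ =>
    integrable_log_sub_spectralMeasure C J (vl u) hz]
  congr 1
  have : (Fintype.card V : ℂ) ≠ 0 := by exact_mod_cast Fintype.card_ne_zero
  rw [ENNReal.toReal_inv, ENNReal.toReal_natCast, Complex.real_smul]
  push_cast
  rw [mul_inv_cancel_left₀ this]

theorem hasDerivAt_floquet (hV : Nonempty V) {z : ℂ} (hz : 0 < z.im) :
    HasDerivAt (floquet C J vl) (floquet C J vl z * -∑ u, C.green J (vl u) z) z := by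
  have h1 : ∀ u, HasDerivAt (fun w : ℂ => ∫ t : ℝ, Complex.log ((t : ℂ) - w)
      ∂(spectralMeasure (C.jacobiOp J) (delta (vl u)))) (-C.green J (vl u) z) z := fun u => by
    have h := hasDerivAt_integral_log_sub
      (ae_abs_le_norm_spectralMeasure (C.jacobiOp J) (delta (vl u))) hz
    rwa [integral_inv_sub_spectralMeasure (C.isSelfAdjoint_jacobiOp J) _ hz.ne'] at h
  have h2 := (HasDerivAt.fun_sum (u := Finset.univ) fun u _ => h1 u).cexp
  rw [Finset.sum_neg_distrib, ← floquet_eq C J vl hV hz] at h2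
  refine h2.congr_of_eventuallyEq ?_
  filter_upwards [eventually_im_pos hz] with w hw using floquet_eq C J vl hV hw

theorem floquet_ne_zero (z : ℂ) : floquet C J vl z ≠ 0 := Complex.exp_ne_zero _

/-- The product of `Φ` and the inverse of the right side of the Floquet formula. -/
def floquetRatio (dl : D → C.tree.Dart) (E : Finset D) (z : ℂ) : ℂ :=
  floquet C J vl z * ((∏ u, C.green J (vl u) z) * ∏ e ∈ E, C.edgeDenom J dl e z)

variable {dl : D → C.tree.Dart} {E : Finset D} {vl}

/-- The logarithmic derivatives add up to zero: the vertex sums regroup by initial vertex, the edge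
sums regroup by orientation, and both become the same sum over all directed edges with opposite
signs. -/
theorem hasDerivAt_floquetRatio (hV : Nonempty V) (hE : G.IsOrientation E)
    (hvl : ∀ u, C.proj (vl u) = u) (hdl : ∀ d, C.dartProj (dl d) = d) {z : ℂ} (hz : 0 < z.im) :
    HasDerivAt (floquetRatio C J vl dl E) 0 z := by
  classical
  cases nonempty_fintype D
  have hΦ := hasDerivAt_floquet C J vl hV hz
  have hG := fun u (_ : u ∈ Finset.univ) => C.differentiableAt_green J (vl u) hz.ne'
  have hG0 := fun u (_ : u ∈ Finset.univ) => C.green_ne_zero J (vl u) hz.ne'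
  have hq := fun e (_ : e ∈ E) => C.differentiableAt_edgeDenom J dl e hz.ne'
  have hq0 := fun e (_ : e ∈ E) => C.edgeDenom_ne_zero J dl e hz.ne'
  have hGd : DifferentiableAt ℂ (fun w => ∏ u, C.green J (vl u) w) z :=
    DifferentiableAt.fun_finsetProd hG
  have hqd : DifferentiableAt ℂ (fun w => ∏ e ∈ E, C.edgeDenom J dl e w) z :=
    DifferentiableAt.fun_finsetProd hq
  have hGp := Finset.prod_ne_zero_iff.2 hG0
  have hqp := Finset.prod_ne_zero_iff.2 hq0
  have hd : DifferentiableAt ℂ (floquetRatio C J vl dl E) z :=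
    hΦ.differentiableAt.mul (hGd.mul hqd)
  have hlog : logDeriv (floquetRatio C J vl dl E) z = 0 := by
    unfold floquetRatio
    rw [logDeriv_mul (g := fun w => (∏ u, C.green J (vl u) w) * ∏ e ∈ E, C.edgeDenom J dl e w) z
      (floquet_ne_zero C J vl z) (mul_ne_zero hGp hqp) hΦ.differentiableAt (hGd.mul hqd),
      logDeriv_mul z hGp hqp hGd hqd, logDeriv_prod hG0 hG, logDeriv_prod hq0 hq,
      logDeriv_apply, hΦ.deriv, mul_div_cancel_left₀ _ (floquet_ne_zero C J vl z),
      Finset.sum_congr rfl fun u _ => C.logDeriv_green J hvl hdl u hz,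
      Finset.sum_congr rfl fun d _ => C.logDeriv_edgeDenom J hvl hdl d hz,
      Finset.sum_neg_distrib, ← hE.sum_univ (fun d => (J.a d : ℂ) ^ 2 *
        deriv (C.mFun J (dl d)) z * C.green J (vl (G.src d)) z),
      Finset.sum_add_distrib, Finset.sum_fiberwise Finset.univ G.src (fun d => (J.a d : ℂ) ^ 2 *
        deriv (C.mFun J (dl d)) z * C.green J (vl (G.src d)) z)]
    ring
  rw [logDeriv_apply, div_eq_zero_iff] at hlog
  have h0 : deriv (floquetRatio C J vl dl E) z = 0 :=
    hlog.resolve_right (mul_ne_zero (floquet_ne_zero C J vl z) (mul_ne_zero hGp hqp))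
  rw [← h0]
  exact hd.hasDerivAt

open Filter in
-- Each vertex contributes exp ∫ log(t - iy) dμ_u · G_u, which is normalized by exp(-log(-iy)) on
-- the first factor and by -iy on the second; the two normalizations cancel. The edge denominators
-- tend to 1 because m does to 0.
theorem tendsto_floquetRatio (hV : Nonempty V) :
    Tendsto (fun y : ℝ => floquetRatio C J vl dl E (y * Complex.I)) atTop (𝓝 1) := by
  have him : ∀ y : ℝ, ((y : ℂ) * Complex.I).im = y := by simp
  have hinv : Tendsto (fun y : ℝ => |y|⁻¹) atTop (𝓝 0) := by
    exact tendsto_inv_atTop_zero.comp tendsto_abs_atTop_atTop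
  have hm : ∀ e, Tendsto (fun y : ℝ => C.mFun J e (y * Complex.I)) atTop (𝓝 0) := by
    intro e
    refine squeeze_zero_norm' ?_ hinv
    filter_upwards [eventually_gt_atTop 0] with y hy
    have := norm_resolventEntry_le (C.isSelfAdjoint_plusOp J e) (z := y * Complex.I)
      (by rw [him]; exact hy.ne') ⟨e.snd, C.snd_mem_plusSide e⟩
    rwa [him] at this
  have hq : ∀ e, Tendsto (fun y : ℝ => C.edgeDenom J dl e (y * Complex.I)) atTop (𝓝 1) := by
    intro e
    have := (((hm (dl e)).const_mul ((J.a e : ℂ) ^ 2)).mul (hm (dl (G.inv e)))).const_sub 1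
    simpa [UniversalCover.edgeDenom] using this
  have hG : ∀ x, Tendsto (fun y : ℝ => -(y * Complex.I) * C.green J x (y * Complex.I)) atTop
      (𝓝 1) := by
    intro x
    have h0 : Tendsto (fun y : ℝ => 1 + (y * Complex.I) * C.green J x (y * Complex.I)) atTop
        (𝓝 0) := by
      have hb : Tendsto (fun y : ℝ => ‖C.jacobiOp J‖ * |y|⁻¹) atTop (𝓝 0) := by
        simpa using hinv.const_mul ‖C.jacobiOp J‖
      refine squeeze_zero_norm' ?_ hb
      filter_upwards [eventually_gt_atTop 0] with y hy
      have := norm_one_add_mul_resolventEntry_le (C.isSelfAdjoint_jacobiOp J)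
        (z := y * Complex.I) (by rw [him]; exact hy.ne') x
      rwa [him] at this
    have := h0.const_sub 1
    rw [sub_zero] at this
    refine this.congr fun y => by ring
  have hL : ∀ x, Tendsto (fun y : ℝ => Complex.exp ((∫ t : ℝ, Complex.log ((t : ℂ) - y * Complex.I)
      ∂(spectralMeasure (C.jacobiOp J) (delta x))) - Complex.log (-(y * Complex.I)))) atTop
      (𝓝 1) := by
    intro x
    rw [← Complex.exp_zero]
    refine (Complex.continuous_exp.tendsto 0).comp ?_
    have hb : Tendsto (fun y : ℝ => 3 / 2 * (‖C.jacobiOp J‖ / y)) atTop (𝓝 0) := by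
      simpa using (tendsto_const_nhds.div_atTop tendsto_id).const_mul (3 / 2 : ℝ)
    refine squeeze_zero_norm' ?_ hb
    have := isProbabilityMeasure_jacobiOp C J x
    filter_upwards [eventually_gt_atTop 0, eventually_ge_atTop (2 * ‖C.jacobiOp J‖)] with y hy hy2
    exact norm_integral_log_sub_le (ae_abs_le_norm_spectralMeasure _ _) hy hy2
  have h := ((tendsto_finsetProd (Finset.univ : Finset V) fun u _ => (hL (vl u)).mul (hG (vl u))).mul
    (tendsto_finsetProd E fun e _ => hq e))
  simp only [mul_one, Finset.prod_const_one] at h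
  refine h.congr' ?_
  filter_upwards [eventually_gt_atTop 0] with y hy
  have hy' : -((y : ℂ) * Complex.I) ≠ 0 := by simp [hy.ne']
  rw [floquetRatio, floquet_eq C J vl hV (by rwa [him]), Complex.exp_sum, ← mul_assoc,
    ← Finset.prod_mul_distrib]
  congr 1
  refine Finset.prod_congr rfl fun u _ => ?_
  rw [Complex.exp_sub, Complex.exp_log hy', ← mul_assoc, div_mul_cancel₀ _ hy']

theorem floquetRatio_eq_one (hV : Nonempty V) (hE : G.IsOrientation E)
    (hvl : ∀ u, C.proj (vl u) = u) (hdl : ∀ d, C.dartProj (dl d) = d) {z : ℂ} (hz : 0 < z.im) :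
    floquetRatio C J vl dl E z = 1 := by
  have hconst : ∀ w : ℂ, 0 < w.im →
      floquetRatio C J vl dl E w = floquetRatio C J vl dl E z := fun w hw =>
    (isOpen_lt continuous_const Complex.continuous_im).is_const_of_deriv_eq_zero
      UniversalCover.isPreconnected_upperHalf
      (fun w hw => (hasDerivAt_floquetRatio C J hV hE hvl hdl
        hw).differentiableAt.differentiableWithinAt)
      (fun w hw => (hasDerivAt_floquetRatio C J hV hE hvl hdl hw).deriv) hw hz
  refine tendsto_nhds_unique (Filter.Tendsto.congr' ?_ tendsto_const_nhds)
    (tendsto_floquetRatio C J (dl := dl) (E := E) (vl := vl) hV)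
  filter_upwards [Filter.eventually_gt_atTop 0] with y hy
  exact (hconst _ (by simpa using hy)).symm

theorem floquet_eq_prod_div_prod (hV : Nonempty V) (hE : G.IsOrientation E)
    (hvl : ∀ u, C.proj (vl u) = u) (hdl : ∀ d, C.dartProj (dl d) = d) {z : ℂ} (hz : 0 < z.im) :
    floquet C J vl z = (∏ e ∈ E, Qfun C J dl e z) / ∏ u, C.green J (vl u) z := by
  have h := floquetRatio_eq_one C J hV hE hvl hdl hz
  rw [floquetRatio] at h
  have hGp := Finset.prod_ne_zero_iff.2 fun u (_ : u ∈ (Finset.univ : Finset V)) =>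
    C.green_ne_zero J (vl u) hz.ne'
  have hqp := Finset.prod_ne_zero_iff.2 fun e (_ : e ∈ E) => C.edgeDenom_ne_zero J dl e hz.ne'
  have hQ : ∏ e ∈ E, Qfun C J dl e z = 1 / ∏ e ∈ E, C.edgeDenom J dl e z := by
    rw [one_div, ← Finset.prod_inv_distrib]
    exact Finset.prod_congr rfl fun e _ => one_div _
  rw [hQ, eq_div_iff hGp, eq_div_iff hqp, mul_assoc, h]

end FloquetFormula

/-! ### An algebraicity criterion. -/

open scoped KaehlerDifferential in
/-- A solution of the system `m_n (β_n - ∑ w_nl m_l) = 1` with an invertible Jacobian matrix is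
algebraic, since the differentials of its entries vanish. -/
theorem isAlgebraic_of_jacobian_over_field {k K N : Type*} [Field k] [Field K] [Algebra k K] [Fintype N]
    [DecidableEq N] (m : N → K) (β : N → k) (w : N → N → k)
    (heq : ∀ n, m n * (algebraMap k K (β n) - ∑ l, algebraMap k K (w n l) * m l) = 1)
    (hdet : (Matrix.of fun n l => (if n = l then
      algebraMap k K (β n) - ∑ l, algebraMap k K (w n l) * m l else 0) -
        m n * algebraMap k K (w n l)).det ≠ 0) (n : N) : IsAlgebraic k (m n) := by
  classical
  set L : IntermediateField k K := IntermediateField.adjoin k (Set.range m) with hL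
  have hm : ∀ n, m n ∈ L := fun n => IntermediateField.subset_adjoin _ _ ⟨n, rfl⟩
  let m' : N → L := fun n => ⟨m n, hm n⟩
  -- Finite generation is what lets unramified be upgraded to separable, hence algebraic, below.
  have hfin : Algebra.EssFiniteType k L := by
    rw [IntermediateField.essFiniteType_iff]
    exact ⟨Finset.univ.image m, by rw [hL]; congr 1; simp⟩
  have heq' : ∀ n, m' n * (algebraMap k L (β n) - ∑ l, algebraMap k L (w n l) * m' l) = 1 := by
    intro n
    apply (algebraMap L K).injective
    simpa [m'] using heq n
  let M : Matrix N N L := Matrix.of fun n l => (if n = l then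
      algebraMap k L (β n) - ∑ l, algebraMap k L (w n l) * m' l else 0) -
        m' n * algebraMap k L (w n l)
  have hM : M.det ≠ 0 := by
    intro h
    apply hdet
    have h2 := congrArg (algebraMap L K) h
    rw [RingHom.map_det, map_zero] at h2
    refine Eq.trans ?_ h2
    congr 1
    ext i j
    simp only [M, Matrix.of_apply, RingHom.mapMatrix_apply, Matrix.map_apply]
    split_ifs <;> simp [m']
  have hD : ∀ n, KaehlerDifferential.D k L (m' n) = 0 := by
    -- Differentiating the system gives M · dm = 0. Linear functionals turn the differentials into a
    -- vector over L, to which the invertibility of M applies.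
    have key : ∀ φ : Module.Dual L (Ω[L⁄k]), ∀ n, φ (KaehlerDifferential.D k L (m' n)) = 0 := by
      intro φ
      have hz := Matrix.eq_zero_of_mulVec_eq_zero hM
        (v := fun n => φ (KaehlerDifferential.D k L (m' n))) (by
          ext i
          have h := congrArg (fun x => φ (KaehlerDifferential.D k L x)) (heq' i)
          simp only [Derivation.leibniz, map_sub, map_sum, Derivation.map_algebraMap, smul_zero,
            map_add, map_smul, zero_sub, add_zero, Derivation.map_one_eq_zero, map_zero,
            smul_eq_mul, map_neg] at h
          simp only [Matrix.mulVec, dotProduct, M, Matrix.of_apply, sub_mul, ite_mul, zero_mul,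
            Finset.sum_sub_distrib, Finset.sum_ite_eq, Finset.mem_univ, if_true, Pi.zero_apply]
          rw [← h]
          simp only [mul_assoc, ← Finset.mul_sum]
          ring_nf)
      exact fun n => congrFun hz n
    intro n
    exact (Module.forall_dual_apply_eq_zero_iff L _).1 fun φ => key φ n
  have hD' : ∀ x (hx : x ∈ L), KaehlerDifferential.D k L ⟨x, hx⟩ = 0 := by
    intro x hx
    induction hx using IntermediateField.adjoin_induction with
    | mem x hx => obtain ⟨n, rfl⟩ := hx; exact hD n
    | algebraMap x => exact Derivation.map_algebraMap _ x
    | add x y hx hy h1 h2 =>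
      have := (KaehlerDifferential.D k L).map_add ⟨x, hx⟩ ⟨y, hy⟩
      rw [h1, h2, add_zero] at this
      exact this
    | inv x hx h1 =>
      have := (KaehlerDifferential.D k L).leibniz_inv ⟨x, hx⟩
      rw [h1, smul_zero] at this
      exact this
    | mul x y hx hy h1 h2 =>
      have := (KaehlerDifferential.D k L).leibniz ⟨x, hx⟩ ⟨y, hy⟩
      rw [h1, h2, smul_zero, smul_zero, add_zero] at this
      exact this
  have hun : Algebra.FormallyUnramified k L := by
    refine ⟨⟨fun a b => ?_⟩⟩
    have htop := KaehlerDifferential.span_range_derivation k L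
    have hbot : Submodule.span L (Set.range (KaehlerDifferential.D k L)) = ⊥ := by
      rw [Submodule.span_eq_bot]
      rintro _ ⟨x, rfl⟩
      exact hD' x.1 x.2
    rw [htop] at hbot
    have h0 : ∀ c : Ω[L⁄k], c = 0 := fun c => by
      rw [← Submodule.mem_bot L, ← hbot]; trivial
    rw [h0 a, h0 b]
  have hsep := Algebra.FormallyUnramified.isSeparable k L
  have := (Algebra.IsAlgebraic.isAlgebraic (R := k) (m' n)).algebraMap (A := K)
  exact this

/-- Algebraicity over a domain and over its fraction field agree, so R may be replaced by a field.
-/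
theorem isAlgebraic_of_jacobian_in_field {R K N : Type*} [CommRing R] [IsDomain R] [Field K]
    [Algebra R K] [FaithfulSMul R K] [Fintype N] [DecidableEq N] (m : N → K) (β : N → R)
    (w : N → N → R)
    (heq : ∀ n, m n * (algebraMap R K (β n) - ∑ l, algebraMap R K (w n l) * m l) = 1)
    (hdet : (Matrix.of fun n l => (if n = l then
      algebraMap R K (β n) - ∑ l, algebraMap R K (w n l) * m l else 0) -
        m n * algebraMap R K (w n l)).det ≠ 0) (n : N) : IsAlgebraic R (m n) := by
  let := FractionRing.liftAlgebra R K
  have := FractionRing.isScalarTower_liftAlgebra R K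
  rw [IsFractionRing.isAlgebraic_iff R (FractionRing R) K]
  refine isAlgebraic_of_jacobian_over_field m (fun n => algebraMap R _ (β n))
    (fun n l => algebraMap R _ (w n l)) ?_ ?_ n
  · simpa only [← IsScalarTower.algebraMap_apply] using heq
  · simpa only [← IsScalarTower.algebraMap_apply] using hdet

theorem isAlgebraic_of_jacobian {R S N : Type*} [CommRing R] [IsDomain R] [CommRing S]
    [IsDomain S] [Algebra R S] [FaithfulSMul R S] [Fintype N] [DecidableEq N] (m : N → S)
    (β : N → R) (w : N → N → R)
    (heq : ∀ n, m n * (algebraMap R S (β n) - ∑ l, algebraMap R S (w n l) * m l) = 1)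
    (hdet : (Matrix.of fun n l => (if n = l then
      algebraMap R S (β n) - ∑ l, algebraMap R S (w n l) * m l else 0) -
        m n * algebraMap R S (w n l)).det ≠ 0) (n : N) : IsAlgebraic R (m n) := by
  have hinj := IsFractionRing.injective S (FractionRing S)
  have hRK : FaithfulSMul R (FractionRing S) := by
    rw [faithfulSMul_iff_algebraMap_injective, IsScalarTower.algebraMap_eq R S]
    exact hinj.comp (FaithfulSMul.algebraMap_injective R S)
  rw [← isAlgebraic_algebraMap_iff hinj]
  refine isAlgebraic_of_jacobian_in_field (fun n => algebraMap S (FractionRing S) (m n)) β w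
    (fun n => ?_) (fun h => hdet (hinj ?_)) n
  · rw [← map_one (algebraMap S (FractionRing S)), ← heq n]
    simp only [map_mul, map_sub, map_sum, ← IsScalarTower.algebraMap_apply]
  · rw [RingHom.map_det, map_zero]
    refine Eq.trans ?_ h
    congr 1
    ext i j
    simp only [Matrix.of_apply, RingHom.mapMatrix_apply, Matrix.map_apply]
    split_ifs <;> simp only [map_mul, map_sub, map_sum, map_zero, ← IsScalarTower.algebraMap_apply]

theorem IsAlgebraic.of_mul_eq {R S : Type*} [CommRing R] [IsDomain R] [CommRing S] [IsDomain S]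
    [Algebra R S] {x a b : S} (ha : IsAlgebraic R a) (hb : IsAlgebraic R b) (ha0 : a ≠ 0)
    (h : x * a = b) : IsAlgebraic R x := by
  have hinj := IsFractionRing.injective S (FractionRing S)
  rw [← isAlgebraic_algebraMap_iff hinj] at ha hb ⊢
  have ha0' : algebraMap S (FractionRing S) a ≠ 0 := by
    rwa [Ne, map_eq_zero_iff _ hinj]
  have hx : algebraMap S (FractionRing S) x = algebraMap S _ b / algebraMap S _ a :=
    eq_div_of_mul_eq ha0' (by rw [← map_mul, h])
  rw [hx, div_eq_mul_inv]
  exact hb.mul (IsAlgebraic.inv_iff.2 ha)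

/-! ### The domain of analytic functions on the upper half plane. -/

section AnalyticFunctions

/-- The algebra of analytic functions on the upper half plane. -/
def analyticUpperHalf : Subalgebra ℂ ({z : ℂ // 0 < z.im} → ℂ) where
  carrier := {f | ∃ F : ℂ → ℂ, AnalyticOnNhd ℂ F {z | 0 < z.im} ∧ ∀ z, f z = F z}
  mul_mem' := by
    rintro f g ⟨F, hF, hf⟩ ⟨F', hF', hg⟩
    exact ⟨fun z => F z * F' z, hF.mul hF', fun z => by rw [Pi.mul_apply, hf, hg]⟩
  add_mem' := by
    rintro f g ⟨F, hF, hf⟩ ⟨F', hF', hg⟩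
    exact ⟨fun z => F z + F' z, hF.add hF', fun z => by rw [Pi.add_apply, hf, hg]⟩
  algebraMap_mem' c := ⟨fun _ => c, analyticOnNhd_const, fun _ => rfl⟩

/-- By the identity theorem on the connected half plane. The field-theoretic criterion is applied in
the fraction field of this domain. -/
instance : NoZeroDivisors analyticUpperHalf where
  eq_zero_or_eq_zero_of_mul_eq_zero := by
    rintro ⟨f, F, hF, hf⟩ ⟨g, F', hF', hg⟩ h
    have h' : ∀ z ∈ {z : ℂ | 0 < z.im}, F z * F' z = 0 := fun z hz => by
      have := congrFun (congrArg Subtype.val h) ⟨z, hz⟩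
      change f ⟨z, hz⟩ * g ⟨z, hz⟩ = 0 at this
      rwa [hf, hg] at this
    refine (AnalyticOnNhd.eq_zero_or_eq_zero_of_mul_eq_zero hF hF' h'
      UniversalCover.isPreconnected_upperHalf).imp (fun h0 => ?_) (fun h0 => ?_)
    · exact Subtype.ext (funext fun z => (hf z).trans (h0 z.1 z.2))
    · exact Subtype.ext (funext fun z => (hg z).trans (h0 z.1 z.2))

instance : Nontrivial analyticUpperHalf := by
  refine ⟨0, 1, fun h => ?_⟩
  have := congrFun (congrArg Subtype.val h) ⟨Complex.I, by simp⟩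
  exact zero_ne_one this

instance : IsDomain analyticUpperHalf := NoZeroDivisors.to_isDomain _

/-- The restriction of a function to the upper half plane. -/
def AnalyticOnNhd.toUpperHalf {F : ℂ → ℂ} (hF : AnalyticOnNhd ℂ F {z | 0 < z.im}) :
    analyticUpperHalf := ⟨fun z => F z, F, hF, fun _ => rfl⟩

/-- Evaluation at a point of the upper half plane. -/
def evalUpperHalf (z : {z : ℂ // 0 < z.im}) : analyticUpperHalf →ₐ[ℂ] ℂ :=
  (Pi.evalAlgHom ℂ (fun _ => ℂ) z).comp analyticUpperHalf.val

theorem evalUpperHalf_ext {f g : analyticUpperHalf}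
    (h : ∀ z, evalUpperHalf z f = evalUpperHalf z g) : f = g :=
  Subtype.ext (funext h)

/-- The coordinate function makes the analytic functions an algebra over the polynomials. -/
instance analyticUpperHalf.algebraPolynomial : Algebra ℂ[X] analyticUpperHalf :=
  (Polynomial.aeval (R := ℂ) (analyticOnNhd_id (𝕜 := ℂ)).toUpperHalf).toAlgebra

theorem evalUpperHalf_algebraMap (z : {z : ℂ // 0 < z.im}) (p : ℂ[X]) :
    evalUpperHalf z (algebraMap ℂ[X] analyticUpperHalf p) = p.eval z.1 := by
  change evalUpperHalf z (Polynomial.aeval _ p) = _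
  rw [← Polynomial.aeval_algHom_apply, ← Polynomial.coe_aeval_eq_eval]
  rfl

instance : FaithfulSMul ℂ[X] analyticUpperHalf := by
  rw [faithfulSMul_iff_algebraMap_injective, injective_iff_map_eq_zero]
  intro p hp
  refine Polynomial.eq_zero_of_infinite_isRoot p ?_
  have hinf : Set.Infinite (Set.range fun n : ℕ => ((n : ℂ) + 1) * Complex.I) := by
    refine Set.infinite_range_of_injective fun n n' h => ?_
    have := mul_right_cancel₀ Complex.I_ne_zero h
    exact_mod_cast add_right_cancel this
  refine hinf.mono ?_
  rintro _ ⟨n, rfl⟩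
  have hn : 0 < (((n : ℂ) + 1) * Complex.I).im := by simp; positivity
  have := evalUpperHalf_algebraMap ⟨_, hn⟩ p
  rw [hp, map_zero] at this
  exact this.symm

theorem isAlgebraicFunctionOn_of_isAlgebraic {F : ℂ → ℂ} (hF : AnalyticOnNhd ℂ F {z | 0 < z.im})
    (h : IsAlgebraic ℂ[X] hF.toUpperHalf) : IsAlgebraicFunctionOn F {z | 0 < z.im} := by
  obtain ⟨P, hP, h0⟩ := h
  refine ⟨P, hP, fun z hz => ?_⟩
  have h1 := congrArg (evalUpperHalf ⟨z, hz⟩) h0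
  rw [map_zero, Polynomial.aeval_def] at h1
  have h2 := Polynomial.hom_eval₂ P (algebraMap ℂ[X] analyticUpperHalf)
    (evalUpperHalf ⟨z, hz⟩ : analyticUpperHalf →+* ℂ) hF.toUpperHalf
  have h3 : (evalUpperHalf ⟨z, hz⟩ : analyticUpperHalf →+* ℂ).comp
      (algebraMap ℂ[X] analyticUpperHalf) = Polynomial.evalRingHom z :=
    RingHom.ext fun p => evalUpperHalf_algebraMap ⟨z, hz⟩ p
  rw [h3, Polynomial.eval₂_evalRingHom] at h2
  exact h2.symm.trans h1

end AnalyticFunctions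

/-! ### Algebraicity of the m-functions and of Φ. -/

section Algebraic

variable {V D X : Type*} [Fintype V] [Finite D] {G : MGraph V D} (C : UniversalCover G X)
  (J : JacobiParameters G) {vl : V → X} {dl : D → C.tree.Dart} {E : Finset D}

theorem UniversalCover.analyticOnNhd_mFun (e : C.tree.Dart) :
    AnalyticOnNhd ℂ (C.mFun J e) {z | 0 < z.im} :=
  analyticOnNhd_resolventEntry (C.isSelfAdjoint_plusOp J e) _

theorem isAlgebraic_mFun (hdl : ∀ d, C.dartProj (dl d) = d) (d : D) :
    IsAlgebraic ℂ[X] (C.analyticOnNhd_mFun J (dl d)).toUpperHalf := by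
  classical
  cases nonempty_fintype D
  let m : D → analyticUpperHalf := fun d => (C.analyticOnNhd_mFun J (dl d)).toUpperHalf
  let β : D → ℂ[X] := fun d => Polynomial.C (J.b (G.tgt d) : ℂ) - Polynomial.X
  let w : D → D → ℂ[X] := fun n l =>
    if G.src l = G.tgt n ∧ l ≠ G.inv n then Polynomial.C ((J.a l : ℂ) ^ 2) else 0
  have hw : ∀ n l z, evalUpperHalf z (algebraMap ℂ[X] analyticUpperHalf (w n l)) =
      if G.src l = G.tgt n ∧ l ≠ G.inv n then (J.a l : ℂ) ^ 2 else 0 := fun n l z => by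
    rw [evalUpperHalf_algebraMap]
    simp only [w]
    split_ifs <;> simp
  have hm : ∀ n z, evalUpperHalf z (m n) = C.mFun J (dl n) z.1 := fun _ _ => rfl
  have hβ : ∀ n z, evalUpperHalf z (algebraMap ℂ[X] analyticUpperHalf (β n)) =
      J.b (G.tgt n) - z.1 := fun n z => by
    rw [evalUpperHalf_algebraMap]
    simp [β]
  have heq : ∀ n, m n * (algebraMap ℂ[X] analyticUpperHalf (β n) -
      ∑ l, algebraMap ℂ[X] analyticUpperHalf (w n l) * m l) = 1 := by
    intro n
    refine evalUpperHalf_ext fun z => ?_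
    have h := C.mFun_mul_eq_one J hdl n z.2
    rw [Finset.sum_filter] at h
    simp only [map_mul, map_sub, map_sum, map_one, hw, hm, hβ, ite_mul, zero_mul]
    exact h
  refine isAlgebraic_of_jacobian m β w heq (fun hdet => ?_) d
  set S := ∑ d, J.a d ^ 2 with hS
  have hS0 : 0 ≤ S := by positivity
  -- At z = i(S + 1) the Jacobian is strictly diagonally dominant: |m| ≤ 1/(S + 1), and the Schur
  -- factor on the diagonal is 1/m.
  have him : 0 < (((S + 1 : ℝ) : ℂ) * Complex.I).im := by simp; linarith
  let z : {z : ℂ // 0 < z.im} := ⟨_, him⟩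
  have hz : |z.1.im| = S + 1 := by
    change |(((S + 1 : ℝ) : ℂ) * Complex.I).im| = S + 1
    rw [abs_of_pos him]
    simp
  have h := congrArg (evalUpperHalf z) hdet
  rw [AlgHom.map_det, map_zero] at h
  revert h
  refine det_ne_zero_of_sum_row_lt_diag fun n => ?_
  set s := algebraMap ℂ[X] analyticUpperHalf (β n) -
      ∑ l, algebraMap ℂ[X] analyticUpperHalf (w n l) * m l with hs
  set μ := evalUpperHalf z (m n) with hμ
  set ω : D → ℂ := fun l => evalUpperHalf z (algebraMap ℂ[X] analyticUpperHalf (w n l)) with hω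
  have hμs : μ * evalUpperHalf z s = 1 := by rw [hμ, ← map_mul, heq, map_one]
  have hμ0 : μ ≠ 0 := left_ne_zero_of_mul_eq_one hμs
  have hμn : ‖μ‖ ≤ (S + 1)⁻¹ := by
    rw [← hz]
    exact norm_resolventEntry_le (C.isSelfAdjoint_plusOp J (dl n)) z.2.ne' _
  have hωn : ∑ l, ‖ω l‖ ≤ S := by
    refine Finset.sum_le_sum fun l _ => ?_
    simp only [hω, hw]
    split_ifs
    · simp
    · simpa using sq_nonneg (J.a l)
  have hoff : ∀ l ∈ Finset.univ.erase n, ‖((evalUpperHalf z).mapMatrix (Matrix.of fun n l =>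
      (if n = l then algebraMap ℂ[X] analyticUpperHalf (β n) -
        ∑ l, algebraMap ℂ[X] analyticUpperHalf (w n l) * m l else 0) -
          m n * algebraMap ℂ[X] analyticUpperHalf (w n l))) n l‖ = ‖μ‖ * ‖ω l‖ := by
    intro l hl
    have hl' : n ≠ l := (Finset.ne_of_mem_erase hl).symm
    simp only [AlgHom.mapMatrix_apply, Matrix.map_apply, Matrix.of_apply, if_neg hl', zero_sub,
      map_neg, norm_neg, map_mul, norm_mul]
    rfl
  rw [Finset.sum_congr rfl hoff, ← Finset.mul_sum]
  simp only [AlgHom.mapMatrix_apply, Matrix.map_apply, Matrix.of_apply, if_true, map_sub, map_mul]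
  rw [← map_sub]
  -- The full row sum, including the correction m_n w_nn on the diagonal, is at most S, and S < S +
  -- 1 ≤ 1/|m|.
  have hlarge : ‖μ‖ * (‖ω n‖ + ∑ l ∈ Finset.univ.erase n, ‖ω l‖) < ‖evalUpperHalf z s‖ := by
    rw [Finset.add_sum_erase Finset.univ (fun l => ‖ω l‖) (Finset.mem_univ n), eq_inv_of_mul_eq_one_right hμs, norm_inv]
    have hμ1 : 0 < ‖μ‖ := norm_pos_iff.2 hμ0
    have h1 : (S + 1) ≤ ‖μ‖⁻¹ := (le_inv_comm₀ hμ1 (by linarith)).1 hμn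
    have h2 : (S + 1)⁻¹ ≤ 1 := inv_le_one_of_one_le₀ (by linarith)
    calc ‖μ‖ * ∑ l, ‖ω l‖ ≤ 1 * S :=
          mul_le_mul (hμn.trans h2) hωn (Finset.sum_nonneg fun _ _ => norm_nonneg _) zero_le_one
      _ < ‖μ‖⁻¹ := by linarith
  have h3 := norm_sub_norm_le (evalUpperHalf z s) (μ * ω n)
  rw [norm_mul] at h3
  have h4 : ‖μ‖ * ∑ l ∈ Finset.univ.erase n, ‖ω l‖ < ‖evalUpperHalf z s - μ * ω n‖ := by
    linarith
  exact h4

theorem isAlgebraicFunctionOn_floquet (hV : Nonempty V) (hE : G.IsOrientation E)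
    (hvl : ∀ u, C.proj (vl u) = u) (hdl : ∀ d, C.dartProj (dl d) = d) :
    IsAlgebraicFunctionOn (floquet C J vl) {z | 0 < z.im} := by
  classical
  cases nonempty_fintype D
  have hΦ : AnalyticOnNhd ℂ (floquet C J vl) {z | 0 < z.im} :=
    DifferentiableOn.analyticOnNhd (fun z hz =>
      (hasDerivAt_floquet C J vl hV hz).differentiableAt.differentiableWithinAt)
      (isOpen_lt continuous_const Complex.continuous_im)
  refine isAlgebraicFunctionOn_of_isAlgebraic hΦ ?_
  let A := Subalgebra.algebraicClosure ℂ[X] analyticUpperHalf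
  let m : D → analyticUpperHalf := fun d => (C.analyticOnNhd_mFun J (dl d)).toUpperHalf
  let c : ℂ[X] → analyticUpperHalf := algebraMap ℂ[X] analyticUpperHalf
  have hmA : ∀ d, m d ∈ A := isAlgebraic_mFun C J hdl
  have hcA : ∀ p, c p ∈ A := A.algebraMap_mem
  -- g represents 1/G_u as a polynomial in z and the m-functions, so the formula takes the
  -- division-free form Φ ∏ q_e = ∏ g_u.
  let g : V → analyticUpperHalf := fun u => c (Polynomial.C (J.b u : ℂ) - Polynomial.X) -
    ∑ d with G.src d = u, c (Polynomial.C ((J.a d : ℂ) ^ 2)) * m d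
  let q : D → analyticUpperHalf := fun e =>
    1 - c (Polynomial.C ((J.a e : ℂ) ^ 2)) * m e * m (G.inv e)
  have hgA : ∏ u, g u ∈ A := A.prod_mem fun u _ => A.sub_mem (hcA _)
    (A.sum_mem fun d _ => A.mul_mem (hcA _) (hmA d))
  have hqA : ∏ e ∈ E, q e ∈ A := A.prod_mem fun e _ => A.sub_mem A.one_mem
    (A.mul_mem (A.mul_mem (hcA _) (hmA e)) (hmA _))
  have hc : ∀ p z, evalUpperHalf z (c p) = p.eval z.1 := fun p z => evalUpperHalf_algebraMap z p
  have hm : ∀ n z, evalUpperHalf z (m n) = C.mFun J (dl n) z.1 := fun _ _ => rfl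
  have hg : ∀ u z, C.green J (vl u) z.1 * evalUpperHalf z (g u) = 1 := fun u z => by
    rw [← C.green_mul_eq_one J hvl hdl u z.2]
    simp [g, hc, hm]
  have hq : ∀ e z, evalUpperHalf z (q e) = C.edgeDenom J dl e z.1 := fun e z => by
    simp [q, hc, hm, UniversalCover.edgeDenom]
  refine IsAlgebraic.of_mul_eq hqA hgA ?_ (evalUpperHalf_ext fun z => ?_)
  · refine Finset.prod_ne_zero_iff.2 fun e _ h => ?_
    have h1 := hq e ⟨Complex.I, by simp⟩
    rw [h, map_zero] at h1
    exact C.edgeDenom_ne_zero J dl e (by simp) h1.symm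
  · have h1 := floquetRatio_eq_one C J hV hE hvl hdl z.2
    have h2 : (∏ u, C.green J (vl u) z.1) * ∏ u, evalUpperHalf z (g u) = 1 := by
      rw [← Finset.prod_mul_distrib]
      exact Finset.prod_eq_one fun u _ => hg u z
    rw [floquetRatio] at h1
    simp only [map_mul, map_prod, hq]
    change floquet C J vl z.1 * _ = _
    linear_combination (∏ u, evalUpperHalf z (g u)) * h1 -
      floquet C J vl z.1 * (∏ e ∈ E, C.edgeDenom J dl e z.1) * h2

end Algebraic

/-! ### Meromorphic continuation. -/

section Meromorphic

variable {V D X : Type*} [Fintype V] [Finite D] {G : MGraph V D} (C : UniversalCover G X)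
  (J : JacobiParameters G)

theorem eventually_notMem_spectrum {ι : Type*} {T : L2 ι →L[ℂ] L2 ι} {w : ℂ}
    (hw : w ∈ (spectrum ℂ T)ᶜ ∪ isolatedPointSpectrum T) : ∀ᶠ z in 𝓝[≠] w, z ∉ spectrum ℂ T := by
  rcases hw with hw | hw
  · exact nhdsWithin_le_nhds ((spectrum.isClosed (𝕜 := ℂ) T).isOpen_compl.mem_nhds hw)
  · exact hw.2

theorem meromorphicAt_green (x : X) {w : ℂ}
    (hw : ∀ᶠ z in 𝓝[≠] w, z ∉ spectrum ℂ (C.jacobiOp J)) : MeromorphicAt (C.green J x) w :=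
  meromorphicAt_resolventEntry (C.isSelfAdjoint_jacobiOp J) _ hw

theorem eventually_green_ne_zero (x : X) {w : ℂ}
    (hw : ∀ᶠ z in 𝓝[≠] w, z ∉ spectrum ℂ (C.jacobiOp J)) : ∀ᶠ z in 𝓝[≠] w, C.green J x z ≠ 0 :=
  (meromorphicAt_green C J x hw).eventually_ne_zero_of_im fun _ hz => C.green_ne_zero J x hz

/-- A branch gains spectrum off that of H only at zeros of the Green's function at `e.fst`, and
these do not accumulate at w. -/
theorem eventually_notMem_spectrum_plusOp (e : C.tree.Dart) {w : ℂ}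
    (hw : ∀ᶠ z in 𝓝[≠] w, z ∉ spectrum ℂ (C.jacobiOp J)) :
    ∀ᶠ z in 𝓝[≠] w, z ∉ spectrum ℂ (C.plusOp J e) := by
  filter_upwards [hw, eventually_green_ne_zero C J e.fst hw] with z h1 h2
  exact C.notMem_spectrum_plusOp J e h1 h2

theorem meromorphicAt_mFun (e : C.tree.Dart) {w : ℂ}
    (hw : ∀ᶠ z in 𝓝[≠] w, z ∉ spectrum ℂ (C.jacobiOp J)) : MeromorphicAt (C.mFun J e) w :=
  meromorphicAt_resolventEntry (C.isSelfAdjoint_plusOp J e) _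
    (eventually_notMem_spectrum_plusOp C J e hw)

theorem meromorphicAt_edgeDenom (dl : D → C.tree.Dart) (d : D) {w : ℂ}
    (hw : ∀ᶠ z in 𝓝[≠] w, z ∉ spectrum ℂ (C.jacobiOp J)) :
    MeromorphicAt (C.edgeDenom J dl d) w :=
  (MeromorphicAt.const 1 w).fun_sub (((MeromorphicAt.const _ w).fun_mul
    (meromorphicAt_mFun C J _ hw)).fun_mul (meromorphicAt_mFun C J _ hw))

theorem eventually_edgeDenom_ne_zero (dl : D → C.tree.Dart) (d : D) {w : ℂ}
    (hw : ∀ᶠ z in 𝓝[≠] w, z ∉ spectrum ℂ (C.jacobiOp J)) :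
    ∀ᶠ z in 𝓝[≠] w, C.edgeDenom J dl d z ≠ 0 :=
  (meromorphicAt_edgeDenom C J dl d hw).eventually_ne_zero_of_im
    fun _ hz => C.edgeDenom_ne_zero J dl d hz

theorem meromorphicAt_Qfun (dl : D → C.tree.Dart) (d : D) {w : ℂ}
    (hw : ∀ᶠ z in 𝓝[≠] w, z ∉ spectrum ℂ (C.jacobiOp J)) :
    MeromorphicAt (Qfun C J dl d) w :=
  (MeromorphicAt.const 1 w).fun_div (meromorphicAt_edgeDenom C J dl d hw)

end Meromorphic

end

theorem theorem2p1 {V D X : Type*} [Fintype V] [Finite D]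
    (G : MGraph V D) (hconn : G.Connected) (hleaf : G.Leafless)
    (J : JacobiParameters G) (C : UniversalCover G X)
    -- an orientation of every edge
    (E : Finset D) (hE : G.IsOrientation E)
    -- an arbitrary choice of lifts of the vertices and of the directed edges to the tree
    (vl : V → X) (hvl : ∀ u, C.proj (vl u) = u)
    (dl : D → C.tree.Dart) (hdl : ∀ d, C.dartProj (dl d) = d) :
    (∀ z : ℂ, 0 < z.im →
      MeasureTheory.Integrable (fun t : ℝ => Complex.log ((t : ℂ) - z)) (densityOfStates C J vl) ∧
      floquet C J vl z = (∏ e ∈ E, Qfun C J dl e z) / ∏ u : V, C.green J (vl u) z) ∧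
    MeromorphicOn (fun z => (∏ e ∈ E, Qfun C J dl e z) / ∏ u : V, C.green J (vl u) z)
      ((spectrum ℂ (C.jacobiOp J))ᶜ ∪ isolatedPointSpectrum (C.jacobiOp J)) ∧
    -- outside a discrete subset of that domain, all expressions on the right side are defined
    (∀ w ∈ (spectrum ℂ (C.jacobiOp J))ᶜ ∪ isolatedPointSpectrum (C.jacobiOp J), ∀ᶠ z in 𝓝[≠] w,
      z ∉ spectrum ℂ (C.jacobiOp J) ∧
      (∀ u, C.green J (vl u) z ≠ 0) ∧
      ∀ d, z ∉ spectrum ℂ (C.plusOp J (dl d)) ∧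
        1 - (J.a d : ℂ) ^ 2 * C.mFun J (dl d) z * C.mFun J (dl (G.inv d)) z ≠ 0) ∧
    IsAlgebraicFunctionOn (floquet C J vl) {z | 0 < z.im} := by
  have hV : Nonempty V := hconn.1
  refine ⟨fun z hz => ⟨integrable_log_sub_densityOfStates C J vl hV hz,
    floquet_eq_prod_div_prod C J hV hE hvl hdl hz⟩, fun w hw => ?_, fun w hw => ?_,
    isAlgebraicFunctionOn_floquet C J hV hE hvl hdl⟩
  · have hw' := eventually_notMem_spectrum hw
    exact (MeromorphicAt.fun_prod fun e _ => meromorphicAt_Qfun C J dl e hw').fun_div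
      (MeromorphicAt.fun_prod fun u _ => meromorphicAt_green C J (vl u) hw')
  · have hw' := eventually_notMem_spectrum hw
    filter_upwards [hw', Filter.eventually_all.2 fun u => eventually_green_ne_zero C J (vl u) hw',
      Filter.eventually_all.2 fun d => eventually_notMem_spectrum_plusOp C J (dl d) hw',
      Filter.eventually_all.2 fun d => eventually_edgeDenom_ne_zero C J dl d hw'] with z h1 h2 h3 h4
    exact ⟨h1, h2, fun d => ⟨h3 d, h4 d⟩⟩
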